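/- Let $U\subset\mathbb C=\mathbb R^2$ be a domain with coordinate $z=u+iv$. An *affine maximal map* $\psi:U\to\mathbb R^3$ with conormal map $N=(N_1,N_2,N_3):U\to\mathbb R^3$ is a map given by $$N=\Phi+\bar\Phi,\qquad \psi=2\,\mathrm{Re}\Bigl(i\int(\Phi+\bar\Phi)\times d\Phi\Bigr)$$ for a holomorphic map $\Phi$ from the universal cover of $U$ to $\mathbb C^3$ such that $[\Phi+\bar\Phi,d\Phi,\overline{d\Phi}]$ is not identically zero, where $[\ ,\ ,\ ]$ is the determinant; it is required that $N$ and $\psi$ are single-valued on $U$. It is an *affine maxface* if $N$ is a Euclidean conformal minimal immersion. Let $\psi$ be an affine maxface on $U$ and let $(g,\omega)$, $\omega=\hat\omega\,dz$, be the pair consisting of a meromorphic function $g$ on $U$ and a holomorphic $1$-form $\omega$ on $U$ with $$N=\mathrm{Re}\int\bigl(1-g^2,\ i(1+g^2),\ 2g\bigr)\,\omega .$$ A map $f$ from a neighbourhood of $p$ in $\mathbb R^2$ to $\mathbb R^3$ has $p$ as a *non-degenerate singular point* if $f$ is not an immersion at $p$ and there is a smooth unit normal vector field $n$ of $f$ near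 $p$ such that $\Lambda=[f_u,f_v,n]$ satisfies $d\Lambda(p)\ne0$. It has a *cuspidal edge* at $p$ if, up to local $C^\infty$ diffeomorphisms of the source (taking $0$ to $p$) and of the target (taking $f(p)$ to $0$), its germ at $p$ is that of $(u,v)\mapsto(u,v^2,v^3)$ at $0$. **Proposition.** Let $p\in U$ be a non-degenerate singular point of $\psi$ that is not a pole of $g$. Then $\psi$ has a cuspidal edge at $p$ if and only if $$\bigl((N_1(1-g^2)+iN_2(1+g^2)+2gN_3)\,dg\bigr)(p)\neq0$$ and the following condition, according to the value of $g(p)$, holds: 1. if $|g(p)|\ne1$: $$\mathrm{Im}\Bigl(\bigl(N_1(1+g^2)+iN_2(1-g^2)\bigr)^2\,\overline{g_z}\,\hat\omega\Bigr)(p)\neq0;$$ 2. if $|g(p)|=1$: (a) when $\mathrm{Re}(g(p))\ne0$: $$\mathrm{Im}\Bigl(\bigl(N_2-iN_3\,\mathrm{Re}(g)\bigr)^2\,\overline{g_z}\,g^2\hat\omega\Bigr)(p)\neq0;$$ (b) when $\mathrm{Im}(g(p))\ne0$: $$\mathrm{Im}\Bigl(\bigl(N_1+iN_3\,\mathrm{Im}(g)\bigr)^2\,\overline{g_z}\,g^2\hat\omega\Bigr)(p)\neq0.$$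 If $|g(p)|=1$ and both $\mathrm{Re}(g(p))$ and $\mathrm{Im}(g(p))$ are non-zero, each of (a) and (b) may be used as the condition. -/

import Mathlib

open scoped ContDiff Topology

namespace AffineMaxface

/-- Real three-space in its standard coordinates; the Euclidean inner product is `⬝ᵥ`, the vector
product is `crossProduct`. (The norm carried by this type is used nowhere, only its topology and
its smooth structure are.) -/
abbrev R3 : Type := Fin 3 → ℝ

/-- The determinant function `[a, b, c]` of three-space, over `ℝ` or over `ℂ`. -/
def det3 {R : Type} [CommRing R] (a b c : Fin 3 → R) : R := Matrix.det (Matrix.of ![a, b, c])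

/-- The partial derivative `f_u` in the coordinate `z = u + i v`. -/
noncomputable def partialU (f : ℂ → R3) (z : ℂ) : R3 := fderiv ℝ f z 1

/-- The partial derivative `f_v` in the coordinate `z = u + i v`. -/
noncomputable def partialV (f : ℂ → R3) (z : ℂ) : R3 := fderiv ℝ f z Complex.I

/-! ### Conformal minimal immersions -/

/-- The Euclidean unit normal `(f_u × f_v) / |f_u × f_v|`. -/
noncomputable def gaussMap (f : ℂ → R3) (z : ℂ) : R3 :=
  let n := crossProduct (partialU f z) (partialV f z)
  (Real.sqrt (n ⬝ᵥ n))⁻¹ • n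

/-- The Euclidean mean curvature `(E N - 2 F M + G L) / (2 (E G - F²))` of an immersion with first
fundamental form `E, F, G` and second fundamental form `L, M, N`. -/
noncomputable def meanCurvature (f : ℂ → R3) (z : ℂ) : ℝ :=
  let E := partialU f z ⬝ᵥ partialU f z
  let F := partialU f z ⬝ᵥ partialV f z
  let G := partialV f z ⬝ᵥ partialV f z
  let L := partialU (partialU f) z ⬝ᵥ gaussMap f z
  let M := partialU (partialV f) z ⬝ᵥ gaussMap f z
  let N := partialV (partialV f) z ⬝ᵥ gaussMap f z
  (E * N - 2 * F * M + G * L) / (2 * (E * G - F ^ 2))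

/-- `f` is a Euclidean conformal minimal immersion of the open set `U ⊆ ℂ` into `ℝ³`. -/
structure IsConformalMinimalImmersion (U : Set ℂ) (f : ℂ → R3) : Prop where
  smooth : ContDiffOn ℝ ∞ f U
  immersion : ∀ z ∈ U, Function.Injective (fderiv ℝ f z)
  conformal_length : ∀ z ∈ U, partialU f z ⬝ᵥ partialU f z = partialV f z ⬝ᵥ partialV f z
  conformal_angle : ∀ z ∈ U, partialU f z ⬝ᵥ partialV f z = 0
  minimal : ∀ z ∈ U, meanCurvature f z = 0

/-! ### Affine maximal maps and affine maxfaces -/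

/-- The holomorphic map `Φ : V → ℂ³` is a Weierstrass datum on the open set `V` for the map `ψ`
with conormal map `N`:
`N = Φ + conj Φ` and `ψ = 2 Re (i ∫ (Φ + conj Φ) × dΦ)`. The second equation, in which the
integral is any primitive, is written as `dψ = 2 Re (i (Φ + conj Φ) × Φ_z dz)`. -/
structure IsWeierstrassDatumOn (V : Set ℂ) (ψ N : ℂ → R3) (Φ : ℂ → Fin 3 → ℂ) : Prop where
  isOpen : IsOpen V
  holomorphic : DifferentiableOn ℂ Φ V
  conormal : ∀ z ∈ V, ∀ j, ((N z j : ℝ) : ℂ) = Φ z j + star (Φ z j)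
  differentiable : DifferentiableOn ℝ ψ V
  lelieuvre : ∀ z ∈ V, ∀ (v : ℂ) (j : Fin 3),
    fderiv ℝ ψ z v j =
      2 * (Complex.I * crossProduct (Φ z + star (Φ z)) (deriv Φ z) j * v).re

/-- The coefficient `-2 i [Φ + conj Φ, Φ_z, conj Φ_z]` of the affine metric. -/
noncomputable def affineMetric (Φ : ℂ → Fin 3 → ℂ) (z : ℂ) : ℂ :=
  -2 * Complex.I * det3 (Φ z + star (Φ z)) (deriv Φ z) (star (deriv Φ z))

/-- `ψ : U → ℝ³` is an affine maximal map with conormal map `N : U → ℝ³`.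

The Weierstrass datum `Φ` is in general only defined on the universal cover of `U`. It is given
here by its local branches. Two branches on a connected open set have the same real part `N / 2`,
hence differ by an imaginary constant, so that they continue along paths to a holomorphic map on the
universal cover; the affine metric does not depend on the branch. -/
structure IsAffineMaximalMap (U : Set ℂ) (ψ N : ℂ → R3) : Prop where
  exists_datum : ∀ z ∈ U, ∃ V ⊆ U, z ∈ V ∧ ∃ Φ, IsWeierstrassDatumOn V ψ N Φ
  metric_ne_zero : ∃ V ⊆ U, ∃ Φ, IsWeierstrassDatumOn V ψ N Φ ∧ ∃ z ∈ V, affineMetric Φ z ≠ 0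

/-- An affine maxface: an affine maximal map whose conormal map is a Euclidean conformal minimal
immersion. -/
structure IsAffineMaxface (U : Set ℂ) (ψ N : ℂ → R3) : Prop where
  maximal : IsAffineMaximalMap U ψ N
  conormal_minimal : IsConformalMinimalImmersion U N

/-- `(1 - g², i (1 + g²), 2 g)`. -/
noncomputable def weierstrassVector (a : ℂ) : Fin 3 → ℂ :=
  ![1 - a ^ 2, Complex.I * (1 + a ^ 2), 2 * a]

/-- `(g, ωhat dz)` is the pair that represents the minimal surface `N`, that is `g` is meromorphic on
`U`, `ωhat` is holomorphic on `U` and `N = Re ∫ (1 - g², i (1 + g²), 2 g) ωhat dz`, written as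
`dN = Re ((1 - g², i (1 + g²), 2 g) ωhat dz)`. The last equation is required off the poles of `g`.
(A meromorphic function in normal form is analytic at a point unless it has a pole there.) -/
structure IsWeierstrassPair (U : Set ℂ) (N : ℂ → R3) (g ωhat : ℂ → ℂ) : Prop where
  meromorphic : MeromorphicNFOn g U
  holomorphic : DifferentiableOn ℂ ωhat U
  representation : ∀ z ∈ U, AnalyticAt ℂ g z → ∀ (v : ℂ) (j : Fin 3),
    fderiv ℝ N z v j = (weierstrassVector (g z) j * ωhat z * v).re

/-! ### Singular points -/

/-- `n` is a smooth unit normal vector field of `f` on `V`. -/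
structure IsUnitNormalOn (V : Set ℂ) (f n : ℂ → R3) : Prop where
  smooth : ContDiffOn ℝ ∞ n V
  unit : ∀ z ∈ V, n z ⬝ᵥ n z = 1
  normal : ∀ z ∈ V, ∀ v : ℂ, fderiv ℝ f z v ⬝ᵥ n z = 0

/-- The identifier of singularities `[f_u, f_v, n]`. -/
noncomputable def singularityIdentifier (f n : ℂ → R3) (z : ℂ) : ℝ :=
  det3 (partialU f z) (partialV f z) (n z)

/-- `p` is a non-degenerate singular point of `f`: `f` is not an immersion at `p`, it has a smooth
unit normal field `n` near `p`, and the differential of `[f_u, f_v, n]` does not vanish at `p`.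
(Two unit normal fields near such a point agree up to sign, so `n` does not matter.) -/
def IsNondegenerateSingularPoint (f : ℂ → R3) (p : ℂ) : Prop :=
  ¬ Function.Injective (fderiv ℝ f p) ∧
    ∃ V : Set ℂ, IsOpen V ∧ p ∈ V ∧ ∃ n : ℂ → R3, IsUnitNormalOn V f n ∧
      fderiv ℝ (singularityIdentifier f n) p ≠ 0

/-- The standard cuspidal edge `(u, v) ↦ (u, v², v³)`, with `w = u + i v`. -/
def standardCuspidalEdge (w : ℂ) : R3 := ![w.re, w.im ^ 2, w.im ^ 3]

/-- `f` has a cuspidal edge at `p`: there are `C^∞` diffeomorphisms `σ`, between neighbourhoods of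
`0` and `p` in the plane, and `Θ`, between neighbourhoods of `f p` and `0` in three-space, such that
`Θ ∘ f ∘ σ` is the standard cuspidal edge near `0`. -/
def HasCuspidalEdgeAt (f : ℂ → R3) (p : ℂ) : Prop :=
  ∃ (σ : OpenPartialHomeomorph ℂ ℂ) (Θ : OpenPartialHomeomorph R3 R3),
    (0 ∈ σ.source ∧ σ 0 = p ∧
      ContDiffOn ℝ ∞ σ σ.source ∧ ContDiffOn ℝ ∞ σ.symm σ.target) ∧
    (f p ∈ Θ.source ∧ Θ (f p) = 0 ∧
      ContDiffOn ℝ ∞ Θ Θ.source ∧ ContDiffOn ℝ ∞ Θ.symm Θ.target) ∧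
    ∀ᶠ w in 𝓝 (0 : ℂ), f (σ w) ∈ Θ.source ∧ Θ (f (σ w)) = standardCuspidalEdge w

/-! ### The expressions in the criteria -/

section Criteria

variable (N : ℂ → R3) (g ωhat : ℂ → ℂ) (p : ℂ)

/-- `(N₁ (1 - g²) + i N₂ (1 + g²) + 2 g N₃) g_z` at `p`. -/
noncomputable def nondegeneracyTerm : ℂ :=
  ((N p 0 : ℂ) * (1 - g p ^ 2) + Complex.I * (N p 1 : ℂ) * (1 + g p ^ 2)
    + 2 * g p * (N p 2 : ℂ)) * deriv g p

/-- `Im ((N₁ (1 + g²) + i N₂ (1 - g²))² conj(g_z) ωhat)` at `p`. -/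
noncomputable def cuspTerm : ℝ :=
  (((N p 0 : ℂ) * (1 + g p ^ 2) + Complex.I * (N p 1 : ℂ) * (1 - g p ^ 2)) ^ 2
    * star (deriv g p) * ωhat p).im

/-- `Im ((N₂ - i N₃ Re g)² conj(g_z) g² ωhat)` at `p`. -/
noncomputable def cuspTermRe : ℝ :=
  (((N p 1 : ℂ) - Complex.I * (N p 2 : ℂ) * ((g p).re : ℂ)) ^ 2
    * star (deriv g p) * g p ^ 2 * ωhat p).im

/-- `Im ((N₁ + i N₃ Im g)² conj(g_z) g² ωhat)` at `p`. -/
noncomputable def cuspTermIm : ℝ :=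
  (((N p 0 : ℂ) + Complex.I * (N p 2 : ℂ) * ((g p).im : ℂ)) ^ 2
    * star (deriv g p) * g p ^ 2 * ωhat p).im

end Criteria

end AffineMaxface

/-!
The map `ψ` has conormal map `N`, and the Lelieuvre formula reads `ψ' v = N × N' (i v)`. Hence
`ψ_u × ψ_v = [N, N_u, N_v] N`, and near a non-degenerate singular point the singular set is the
regular zero set of the conormal determinant `[N, N_u, N_v]`. Along it the kernel of `ψ'` is spanned
by the null field `η = (N · N_v) - i (N · N_u)`, which is characterised by `N' (i η)` being a positive
multiple of `N`.

The heart of the proof is that `ψ` has a cuspidal edge at `p` if and only if `η` is transversal to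
the singular curve at `p` (`hasCuspidalEdgeAt_iff_transversal`). That `ψ` is a front comes for free:
as `N` is conformal, `N' η` is orthogonal to `N' (i η)`, hence to `N`.

* Necessity (`transversal_of_hasCuspidalEdgeAt`) holds by the chain rule, since for the standard
  cuspidal edge the singular curve is the first axis and the kernel is the second one.
* For sufficiency (`hasCuspidalEdgeAt_of_transversal`) use the coordinates `(u, v) ↦ c u + v η (c u)`,
  where `c` parametrizes the singular curve. In these coordinates the derivative of `ψ` in `v`
  vanishes on the first axis. All maps are real analytic, so that a rearrangement of double power
  series gives `ψ = A (u, v²) + v³ B (u, v²)` with analytic `A` and `B`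
  (`exists_cusp_decomposition`). Thus `ψ` is the standard cuspidal edge followed by
  `(x, y, z) ↦ A (x, y) + z B (x, y)`, which is a local diffeomorphism because its derivative has
  the columns `ψ' (c' 0)`, `ψ'' / 2` and `ψ''' / 6`, the last two taken along `η p`; their
  determinant is a nonzero multiple of the square of the derivative of `[N, N_u, N_v]` along `η p`
  (`det3_null_derivatives`).

It remains to compute the derivative of `[N, N_u, N_v]` along `η` from the Weierstrass pair.
Up to a positive factor the determinant is `N · (2 Re g, 2 Im g, |g|² - 1)`. With
`s = i ωhat η / |N_u|²` one has `N = Re (s (1 - g², i (1 + g²), 2 g))` at `p`, and the derivative is a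
positive multiple of `Im (s² g' conj ωhat)`. All three expressions of the criteria are multiples of
the latter (`cuspTerm_eq`, `cuspTermRe_eq`, `cuspTermIm_eq`), while the first condition holds at
every non-degenerate singular point (`nondegeneracyTerm_eq`).
-/

namespace AffineMaxface

open scoped Matrix ComplexConjugate

/-! ### Double power series -/

section DoubleSeries

/-- The rearrangement of a double series by total degree. -/
theorem hasSum_antidiagonal {M : Type*} [NormedAddCommGroup M] {f : ℕ × ℕ → M} (hf : Summable f) :
    HasSum (fun m => ∑ kn ∈ Finset.HasAntidiagonal.antidiagonal m, f kn) (∑' kn, f kn) := by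
  have h := (Finset.HasAntidiagonal.sigmaAntidiagonalEquivProd (A := ℕ)).hasSum_iff.2 hf.hasSum
  have h2 := h.sigma (fun m => (hasSum_fintype _))
  convert h2 using 2 with m
  rw [Finset.univ_eq_attach, ← Finset.sum_attach]
  rfl

theorem hasSum_prod_even_add_odd {M : Type*} [NormedAddCommGroup M] {f : ℕ × ℕ → M} {a b : M}
    (ha : HasSum (fun kn : ℕ × ℕ => f (kn.1, 2 * kn.2)) a)
    (hb : HasSum (fun kn : ℕ × ℕ => f (kn.1, 2 * kn.2 + 1)) b) : HasSum f (a + b) := by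
  have i1 : Function.Injective fun kn : ℕ × ℕ => (kn.1, 2 * kn.2) := fun x y h => by
    simp only [Prod.mk.injEq] at h
    ext <;> omega
  have i2 : Function.Injective fun kn : ℕ × ℕ => (kn.1, 2 * kn.2 + 1) := fun x y h => by
    simp only [Prod.mk.injEq] at h
    ext <;> omega
  refine HasSum.add_isCompl ?_ (i1.hasSum_range_iff.2 ha) (i2.hasSum_range_iff.2 hb)
  refine IsCompl.of_eq ?_ ?_
  · ext ⟨k, n⟩
    simp only [Set.inf_eq_inter, Set.mem_inter_iff, Set.mem_range, Prod.mk.injEq, Prod.exists,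
      Set.bot_eq_empty, Set.mem_empty_iff_false, iff_false]
    rintro ⟨⟨_, _, _, _⟩, _, _, _, _⟩
    omega
  · ext ⟨k, n⟩
    simp only [Set.sup_eq_union, Set.mem_union, Set.mem_range, Prod.mk.injEq, Prod.exists,
      Set.top_eq_univ, Set.mem_univ, iff_true]
    rcases Nat.even_or_odd' n with ⟨m, h | h⟩
    · exact Or.inl ⟨k, m, rfl, h.symm⟩
    · exact Or.inr ⟨k, m, rfl, h.symm⟩

theorem hasSum_prod_zero_add_succ {M : Type*} [NormedAddCommGroup M] {f : ℕ × ℕ → M} {a b : M}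
    (ha : HasSum (fun k : ℕ => f (k, 0)) a)
    (hb : HasSum (fun kn : ℕ × ℕ => f (kn.1, kn.2 + 1)) b) : HasSum f (a + b) := by
  have i1 : Function.Injective fun k : ℕ => (k, 0) := fun x y h => by
    simpa using h
  have i2 : Function.Injective fun kn : ℕ × ℕ => (kn.1, kn.2 + 1) := fun x y h => by
    simp only [Prod.mk.injEq] at h
    ext <;> omega
  refine HasSum.add_isCompl ?_ (i1.hasSum_range_iff.2 ha) (i2.hasSum_range_iff.2 hb)
  refine IsCompl.of_eq ?_ ?_
  · ext ⟨k, n⟩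
    simp only [Set.inf_eq_inter, Set.mem_inter_iff, Set.mem_range, Prod.mk.injEq, Prod.exists,
      Set.bot_eq_empty, Set.mem_empty_iff_false, iff_false]
    rintro ⟨⟨_, _, _⟩, _, _, _, _⟩
    omega
  · ext ⟨k, n⟩
    simp only [Set.sup_eq_union, Set.mem_union, Set.mem_range, Prod.mk.injEq, Prod.exists,
      Set.top_eq_univ, Set.mem_univ, iff_true]
    rcases n with _ | n
    · exact Or.inl ⟨k, rfl, rfl⟩
    · exact Or.inr ⟨k, n, rfl, rfl⟩

variable {E : Type*} [NormedAddCommGroup E] [NormedSpace ℝ E]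

/-- The formal multilinear series on `ℝ × ℝ` whose sum is the double power series
`∑ x ^ k * y ^ n • c k n`. -/
noncomputable def doubleSeries (c : ℕ → ℕ → E) : FormalMultilinearSeries ℝ (ℝ × ℝ) E := fun m =>
  ∑ kn ∈ Finset.HasAntidiagonal.antidiagonal m,
    ((ContinuousMultilinearMap.mkPiAlgebra ℝ (Fin m) ℝ).compContinuousLinearMap
      (fun i => if (i : ℕ) < kn.1 then ContinuousLinearMap.fst ℝ ℝ ℝ
        else ContinuousLinearMap.snd ℝ ℝ ℝ)).smulRight (c kn.1 kn.2)

theorem doubleSeries_apply (c : ℕ → ℕ → E) (m : ℕ) (x : ℝ × ℝ) :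
    doubleSeries c m (fun _ => x) =
      ∑ kn ∈ Finset.HasAntidiagonal.antidiagonal m, (x.1 ^ kn.1 * x.2 ^ kn.2) • c kn.1 kn.2 := by
  rw [doubleSeries, sum_apply]
  refine Finset.sum_congr rfl fun kn hkn => ?_
  rw [Finset.HasAntidiagonal.mem_antidiagonal] at hkn
  subst hkn
  simp only [ContinuousMultilinearMap.smulRight_apply,
    ContinuousMultilinearMap.compContinuousLinearMap_apply,
    ContinuousMultilinearMap.mkPiAlgebra_apply]
  congr 1
  rw [Fin.prod_univ_add]
  simp

theorem norm_doubleSeries_le {c : ℕ → ℕ → E} {C R : ℝ} (hR : 0 ≤ R)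
    (hc : ∀ k n, ‖c k n‖ ≤ C * R ^ (k + n)) (m : ℕ) :
    ‖doubleSeries c m‖ ≤ (m + 1) * (C * R ^ m) := by
  have hC : 0 ≤ C := by simpa using (norm_nonneg _).trans (hc 0 0)
  refine ContinuousMultilinearMap.opNorm_le_bound (by positivity) fun v => ?_
  rw [doubleSeries, sum_apply]
  refine (norm_sum_le _ _).trans ?_
  have key : ∀ kn ∈ Finset.HasAntidiagonal.antidiagonal m,
      ‖((ContinuousMultilinearMap.mkPiAlgebra ℝ (Fin m) ℝ).compContinuousLinearMap
      (fun i => if (i : ℕ) < kn.1 then ContinuousLinearMap.fst ℝ ℝ ℝ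
        else ContinuousLinearMap.snd ℝ ℝ ℝ)).smulRight (c kn.1 kn.2) v‖
      ≤ C * R ^ m * ∏ i, ‖v i‖ := by
    intro kn hkn
    rw [Finset.HasAntidiagonal.mem_antidiagonal] at hkn
    simp only [ContinuousMultilinearMap.smulRight_apply,
      ContinuousMultilinearMap.compContinuousLinearMap_apply,
      ContinuousMultilinearMap.mkPiAlgebra_apply, norm_smul, norm_prod]
    rw [mul_comm]
    refine mul_le_mul (by simpa [hkn] using hc kn.1 kn.2)
      (Finset.prod_le_prod (fun _ _ => norm_nonneg _) fun i _ => ?_) (by positivity)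
      (by positivity)
    split_ifs
    · exact norm_fst_le (v i)
    · exact norm_snd_le (v i)
  refine (Finset.sum_le_sum key).trans (le_of_eq ?_)
  rw [Finset.sum_const, Finset.Nat.card_antidiagonal, nsmul_eq_mul]
  push_cast
  ring

theorem summable_double {c : ℕ → ℕ → E} {C R : ℝ} (hR : 0 < R)
    (hc : ∀ k n, ‖c k n‖ ≤ C * R ^ (k + n)) {x : ℝ × ℝ} (hx : ‖x‖ ≤ (2 * R)⁻¹) :
    Summable fun kn : ℕ × ℕ => ‖(x.1 ^ kn.1 * x.2 ^ kn.2) • c kn.1 kn.2‖ := by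
  have hC : 0 ≤ C := by simpa using (norm_nonneg _).trans (hc 0 0)
  have h1 : Summable fun kn : ℕ × ℕ => (C * ((1 / 2 : ℝ) ^ kn.1 * (1 / 2 : ℝ) ^ kn.2)) :=
    ((summable_geometric_two).mul_of_nonneg summable_geometric_two
      (fun _ => by positivity) (fun _ => by positivity)).mul_left C
  refine Summable.of_nonneg_of_le (fun _ => norm_nonneg _) (fun kn => ?_) h1
  rw [norm_smul, norm_mul, norm_pow, norm_pow]
  have e1 : ‖x.1‖ ^ kn.1 ≤ (2 * R)⁻¹ ^ kn.1 :=
    pow_le_pow_left₀ (norm_nonneg _) ((norm_fst_le x).trans hx) _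
  have e2 : ‖x.2‖ ^ kn.2 ≤ (2 * R)⁻¹ ^ kn.2 :=
    pow_le_pow_left₀ (norm_nonneg _) ((norm_snd_le x).trans hx) _
  calc _ ≤ ((2 * R)⁻¹ ^ kn.1 * (2 * R)⁻¹ ^ kn.2) * (C * R ^ (kn.1 + kn.2)) := by
        gcongr
        exact hc _ _
    _ = _ := by
        rw [mul_inv, mul_pow, mul_pow, pow_add, inv_pow R, inv_pow R]
        field_simp

variable [CompleteSpace E]

/-- A double power series with geometrically bounded coefficients has an analytic sum. -/
theorem exists_analyticAt_hasSum {c : ℕ → ℕ → E} {C R : ℝ} (hR : 0 < R)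
    (hc : ∀ k n, ‖c k n‖ ≤ C * R ^ (k + n)) :
    ∃ A : ℝ × ℝ → E, AnalyticAt ℝ A 0 ∧
      ∀ᶠ x in 𝓝 (0 : ℝ × ℝ),
        HasSum (fun kn : ℕ × ℕ => (x.1 ^ kn.1 * x.2 ^ kn.2) • c kn.1 kn.2) (A x) := by
  have hC : 0 ≤ C := by simpa using (norm_nonneg _).trans (hc 0 0)
  have hrad : ((Real.toNNReal (2 * R)⁻¹ : NNReal) : ENNReal) ≤ (doubleSeries c).radius := by
    refine FormalMultilinearSeries.le_radius_of_bound _ C fun m => ?_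
    have h2 : ((m : ℝ) + 1) * (1 / 2) ^ m ≤ 1 := by
      have : (m : ℝ) + 1 ≤ 2 ^ m := by exact_mod_cast Nat.lt_two_pow_self
      rw [one_div, inv_pow, ← div_eq_mul_inv, div_le_one (by positivity)]
      exact this
    calc _ ≤ ((m + 1) * (C * R ^ m)) * ((2 * R)⁻¹) ^ m := by
          gcongr
          · exact norm_doubleSeries_le hR.le hc m
          · rw [Real.coe_toNNReal _ (by positivity)]
      _ = C * (((m : ℝ) + 1) * (1 / 2) ^ m) := by
          rw [mul_inv, mul_pow, inv_pow R]
          field_simp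
      _ ≤ C * 1 := by gcongr
      _ = C := mul_one C
  have hpos : 0 < (doubleSeries c).radius := by
    refine lt_of_lt_of_le ?_ hrad
    rw [ENNReal.coe_pos, Real.toNNReal_pos]
    positivity
  refine ⟨(doubleSeries c).sum, ((doubleSeries c).hasFPowerSeriesOnBall hpos).analyticAt, ?_⟩
  have hball : Metric.closedBall (0 : ℝ × ℝ) (2 * R)⁻¹ ∈ 𝓝 (0 : ℝ × ℝ) :=
    Metric.closedBall_mem_nhds _ (by positivity)
  filter_upwards [hball] with x hx
  have hs := (summable_double hR hc (mem_closedBall_zero_iff.1 hx)).of_norm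
  have h := (hasSum_antidiagonal hs).tsum_eq
  simp only [FormalMultilinearSeries.sum, doubleSeries_apply]
  rw [h]
  exact hs.hasSum

/-- The coefficients of an analytic function of two real variables as a double power series. -/
theorem exists_coeff_of_analyticAt {F : ℝ × ℝ → E} (hF : AnalyticAt ℝ F 0) :
    ∃ (c : ℕ → ℕ → E) (C R : ℝ), 0 < R ∧ 1 ≤ R ∧ (∀ k n, ‖c k n‖ ≤ C * R ^ (k + n)) ∧
      ∀ᶠ x in 𝓝 (0 : ℝ × ℝ),
        HasSum (fun kn : ℕ × ℕ => (x.1 ^ kn.1 * x.2 ^ kn.2) • c kn.1 kn.2) (F x) := by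
  obtain ⟨p, hp⟩ := hF
  obtain ⟨C, r, hC, hr, hCr⟩ := p.le_mul_pow_of_radius_pos hp.radius_pos
  let e (m : ℕ) (s : Finset (Fin m)) : E :=
    p m (fun i => if i ∈ s then ((1 : ℝ), (0 : ℝ)) else (0, 1))
  have he : ∀ m s, ‖e m s‖ ≤ C * r ^ m := fun m s => by
    refine ((p m).le_opNorm _).trans ?_
    have : ∏ i, ‖(if i ∈ s then ((1 : ℝ), (0 : ℝ)) else (0, 1))‖ = 1 :=
      Finset.prod_eq_one fun i _ => by split_ifs <;> simp [Prod.norm_def]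
    rw [this, mul_one]
    exact hCr m
  let c (k n : ℕ) : E := ∑ s : Finset (Fin (k + n)) with s.card = k, e (k + n) s
  have hR : 0 < 2 * r + 1 := by positivity
  have hc : ∀ k n, ‖c k n‖ ≤ C * (2 * r + 1) ^ (k + n) := fun k n => by
    refine (norm_sum_le _ _).trans ?_
    refine (Finset.sum_le_sum fun s _ => he _ s).trans ?_
    rw [Finset.sum_const, nsmul_eq_mul]
    have h1 : ((Finset.univ.filter fun s : Finset (Fin (k + n)) => s.card = k).card : ℝ)
        ≤ 2 ^ (k + n) := by
      have := Finset.card_filter_le (Finset.univ : Finset (Finset (Fin (k + n))))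
        (fun s => s.card = k)
      rw [Finset.card_univ, Fintype.card_finset, Fintype.card_fin] at this
      exact_mod_cast this
    calc _ ≤ 2 ^ (k + n) * (C * r ^ (k + n)) := by gcongr
      _ = C * (2 * r) ^ (k + n) := by rw [mul_pow]; ring
      _ ≤ _ := by gcongr; linarith
  refine ⟨c, C, 2 * r + 1, hR, by linarith, hc, ?_⟩
  have hterm : ∀ (m : ℕ) (x : ℝ × ℝ), p m (fun _ => x) =
      ∑ kn ∈ Finset.HasAntidiagonal.antidiagonal m, (x.1 ^ kn.1 * x.2 ^ kn.2) • c kn.1 kn.2 := by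
    intro m x
    have h1 : (fun _ : Fin m => x) = (fun _ => x.1 • ((1 : ℝ), (0 : ℝ))) +
        (fun _ => x.2 • ((0 : ℝ), (1 : ℝ))) := by
      funext i; ext <;> simp
    rw [h1, ContinuousMultilinearMap.map_add_univ]
    have h2 : ∀ s : Finset (Fin m),
        p m (s.piecewise (fun _ => x.1 • ((1 : ℝ), (0 : ℝ))) (fun _ => x.2 • ((0 : ℝ), (1 : ℝ))))
          = (x.1 ^ s.card * x.2 ^ (m - s.card)) • e m s := by
      intro s
      have h3 : (s.piecewise (fun _ => x.1 • ((1 : ℝ), (0 : ℝ)))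
          (fun _ => x.2 • ((0 : ℝ), (1 : ℝ)))) =
          fun i => (if i ∈ s then x.1 else x.2) •
            (if i ∈ s then ((1 : ℝ), (0 : ℝ)) else (0, 1)) := by
        funext i
        by_cases hi : i ∈ s <;> simp [Finset.piecewise, hi]
      rw [h3, ContinuousMultilinearMap.map_smul_univ]
      congr 1
      rw [Finset.prod_ite, Finset.prod_const, Finset.prod_const]
      congr 2
      · simp
      · rw [Finset.filter_not, Finset.filter_mem_eq_inter, Finset.univ_inter,
          ← Finset.compl_eq_univ_sdiff, Finset.card_compl, Fintype.card_fin]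
    rw [Finset.sum_congr rfl fun s _ => h2 s]
    rw [← Finset.sum_fiberwise_of_maps_to (s := Finset.univ)
      (t := Finset.HasAntidiagonal.antidiagonal m)
      (g := fun s : Finset (Fin m) => (s.card, m - s.card))]
    · refine Finset.sum_congr rfl fun kn hkn => ?_
      rw [Finset.HasAntidiagonal.mem_antidiagonal] at hkn
      subst hkn
      rw [Finset.smul_sum]
      refine Finset.sum_congr ?_ fun s hs => ?_
      · ext s
        simp only [Finset.mem_filter, Finset.mem_univ, true_and, Prod.ext_iff]
        omega
      · simp only [Finset.mem_filter, Finset.mem_univ, true_and] at hs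
        rw [hs]
        simp
    · intro s _
      rw [Finset.HasAntidiagonal.mem_antidiagonal]
      have := s.card_le_univ
      rw [Fintype.card_fin] at this
      omega
  have hball : Metric.closedBall (0 : ℝ × ℝ) (2 * (2 * r + 1))⁻¹ ∈ 𝓝 (0 : ℝ × ℝ) :=
    Metric.closedBall_mem_nhds _ (by positivity)
  have hps := hp.eventually_hasSum
  filter_upwards [hball, hps] with x hx hxs
  have hs := (summable_double hR hc (mem_closedBall_zero_iff.1 hx)).of_norm
  have h := hasSum_antidiagonal hs
  simp only [hterm, zero_add] at hxs
  rw [hxs.unique h]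
  exact hs.hasSum

/-- An analytic function splits into its even and odd parts in the second variable, both of them
analytic functions of the square of that variable. -/
theorem exists_even_odd_decomposition {F : ℝ × ℝ → E} (hF : AnalyticAt ℝ F 0) :
    ∃ A O : ℝ × ℝ → E, AnalyticAt ℝ A 0 ∧ AnalyticAt ℝ O 0 ∧
      ∀ᶠ x in 𝓝 (0 : ℝ × ℝ), F x = A (x.1, x.2 ^ 2) + x.2 • O (x.1, x.2 ^ 2) := by
  obtain ⟨c, C, R, hR, hR1, hc, hs⟩ := exists_coeff_of_analyticAt hF
  have hC : 0 ≤ C := by simpa using (norm_nonneg _).trans (hc 0 0)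
  have hR2 : 0 < R ^ 2 := by positivity
  obtain ⟨A, hA, hAs⟩ := exists_analyticAt_hasSum (c := fun k n => c k (2 * n)) (C := C) hR2
    fun k n => (hc _ _).trans <| by
      rw [← pow_mul]
      exact mul_le_mul_of_nonneg_left (pow_le_pow_right₀ hR1 (by omega)) hC
  obtain ⟨O, hO, hOs⟩ := exists_analyticAt_hasSum (c := fun k n => c k (2 * n + 1)) (C := C * R)
    hR2 fun k n => (hc _ _).trans <| by
      rw [← pow_mul, mul_assoc, ← pow_succ']
      exact mul_le_mul_of_nonneg_left (pow_le_pow_right₀ hR1 (by omega)) hC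
  refine ⟨A, O, hA, hO, ?_⟩
  have ht : Filter.Tendsto (fun x : ℝ × ℝ => (x.1, x.2 ^ 2)) (𝓝 0) (𝓝 0) := by
    have : Continuous fun x : ℝ × ℝ => (x.1, x.2 ^ 2) := by fun_prop
    exact this.tendsto' _ _ (by simp)
  filter_upwards [hs, ht.eventually hAs, ht.eventually hOs] with x hx hxA hxO
  refine hx.unique (hasSum_prod_even_add_odd ?_ ?_)
  · simpa [pow_mul] using hxA
  · convert! hxO.const_smul x.2 using 2 with kn
    rw [smul_smul]
    congr 1
    simp only
    ring

/-- Division by the second variable, with remainder. -/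
theorem exists_division {O : ℝ × ℝ → E} (hO : AnalyticAt ℝ O 0) :
    ∃ B : ℝ × ℝ → E, AnalyticAt ℝ B 0 ∧
      ∀ᶠ x in 𝓝 (0 : ℝ × ℝ), O x = O (x.1, 0) + x.2 • B x := by
  obtain ⟨c, C, R, hR, hR1, hc, hs⟩ := exists_coeff_of_analyticAt hO
  obtain ⟨B, hB, hBs⟩ := exists_analyticAt_hasSum (c := fun k n => c k (n + 1)) (C := C * R)
    hR fun k n => (hc _ _).trans_eq <| by ring
  refine ⟨B, hB, ?_⟩
  have ht : Filter.Tendsto (fun x : ℝ × ℝ => (x.1, (0 : ℝ))) (𝓝 0) (𝓝 0) := by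
    have : Continuous fun x : ℝ × ℝ => (x.1, (0 : ℝ)) := by fun_prop
    exact this.tendsto' _ _ (by simp)
  filter_upwards [hs, ht.eventually hs, hBs] with x hx hx0 hxB
  refine hx.unique (hasSum_prod_zero_add_succ ?_ ?_)
  · have i1 : Function.Injective fun k : ℕ => (k, 0) := fun x y h => by
      simpa using h
    rw [← i1.hasSum_iff] at hx0
    · simpa [Function.comp_def] using hx0
    · rintro ⟨k, n⟩ hkn
      have : n ≠ 0 := by
        rintro rfl
        exact hkn ⟨k, rfl⟩
      simp [this]
  · convert! hxB.const_smul x.2 using 2 with kn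
    rw [smul_smul]
    congr 1
    simp only
    ring

/-- An analytic map whose derivative in the second variable vanishes on the first axis is an
analytic map of `x`, `y²` and `y³` that is affine in the last of them. -/
theorem exists_cusp_decomposition {F : ℝ × ℝ → E} (hF : AnalyticAt ℝ F 0)
    (hF' : ∀ᶠ u in 𝓝 (0 : ℝ), HasDerivAt (fun y => F (u, y)) 0 0) :
    ∃ A B : ℝ × ℝ → E, AnalyticAt ℝ A 0 ∧ AnalyticAt ℝ B 0 ∧
      ∀ᶠ x in 𝓝 (0 : ℝ × ℝ), F x = A (x.1, x.2 ^ 2) + x.2 ^ 3 • B (x.1, x.2 ^ 2) := by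
  obtain ⟨A, O, hA, hO, hAO⟩ := exists_even_odd_decomposition hF
  obtain ⟨B, hB, hOB⟩ := exists_division hO
  refine ⟨A, B, hA, hB, ?_⟩
  have hline : Filter.Tendsto (fun u : ℝ => (u, (0 : ℝ))) (𝓝 0) (𝓝 0) := by
    have : Continuous fun u : ℝ => (u, (0 : ℝ)) := by fun_prop
    exact this.tendsto' _ _ (by simp)
  have hO0 : ∀ᶠ u in 𝓝 (0 : ℝ), O (u, 0) = 0 := by
    filter_upwards [hF', hline.eventually hAO.eventually_nhds,
      hline.eventually hA.eventually_analyticAt, hline.eventually hO.eventually_analyticAt]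
      with u hu hAOu hAu hOu
    have hi : Filter.Tendsto (fun y : ℝ => (u, y)) (𝓝 0) (𝓝 (u, 0)) := by
      have : Continuous fun y : ℝ => (u, y) := by fun_prop
      exact this.tendsto' _ _ (by simp)
    have hsq : HasDerivAt (fun y : ℝ => (u, y ^ 2)) (0, 0) 0 := by
      have h := (hasDerivAt_const (0 : ℝ) u).prodMk (hasDerivAt_pow 2 (0 : ℝ))
      simpa using h
    have hu0 : (u, (0 : ℝ) ^ 2) = (u, 0) := by simp
    have hA1 : HasDerivAt (fun y : ℝ => A (u, y ^ 2)) 0 0 := by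
      have h := (hu0 ▸ hAu.differentiableAt.hasFDerivAt :
        HasFDerivAt A (fderiv ℝ A (u, 0)) (u, (0 : ℝ) ^ 2)).comp_hasDerivAt (0 : ℝ) hsq
      have h0 : ((0 : ℝ), (0 : ℝ)) = 0 := rfl
      rw [h0, map_zero] at h
      exact h
    have hO1 : HasDerivAt (fun y : ℝ => O (u, y ^ 2)) 0 0 := by
      have h := (hu0 ▸ hOu.differentiableAt.hasFDerivAt :
        HasFDerivAt O (fderiv ℝ O (u, 0)) (u, (0 : ℝ) ^ 2)).comp_hasDerivAt (0 : ℝ) hsq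
      have h0 : ((0 : ℝ), (0 : ℝ)) = 0 := rfl
      rw [h0, map_zero] at h
      exact h
    have h2 := hA1.add ((hasDerivAt_id (0 : ℝ)).smul hO1)
    have h3 : HasDerivAt (fun y => F (u, y)) (O (u, 0)) 0 := by
      refine (h2.congr_of_eventuallyEq (hi.eventually hAOu)).congr_deriv ?_
      simp
    exact h3.unique hu
  have ht : Filter.Tendsto (fun x : ℝ × ℝ => (x.1, x.2 ^ 2)) (𝓝 0) (𝓝 0) := by
    have : Continuous fun x : ℝ × ℝ => (x.1, x.2 ^ 2) := by fun_prop
    exact this.tendsto' _ _ (by simp)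
  have ht1 : Filter.Tendsto (fun x : ℝ × ℝ => x.1) (𝓝 0) (𝓝 0) := continuous_fst.tendsto _
  filter_upwards [hAO, ht.eventually hOB, ht1.eventually hO0] with x h1 h2 h3
  rw [h1, h2, h3, zero_add, smul_smul]
  congr 2
  ring

end DoubleSeries

/-! ### A sufficient condition for cuspidal edges -/

section InverseFunction

variable {E : Type*} [NormedAddCommGroup E] [NormedSpace ℝ E] [FiniteDimensional ℝ E]

/-- The analytic inverse function theorem, with a domain on which both the map and its inverse are
analytic. -/
theorem exists_analytic_chart {f : E → E} {a : E} (hf : AnalyticAt ℝ f a)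
    (hinj : Function.Injective (fderiv ℝ f a)) :
    ∃ e : OpenPartialHomeomorph E E, a ∈ e.source ∧ (e : E → E) = f ∧
      (∀ x ∈ e.source, AnalyticAt ℝ f x) ∧ ∀ y ∈ e.target, AnalyticAt ℝ e.symm y := by
  have : CompleteSpace E := FiniteDimensional.complete ℝ E
  have equiv_of_injective : ∀ T : E →L[ℝ] E, Function.Injective T →
      ∃ T' : E ≃L[ℝ] E, (T' : E →L[ℝ] E) = T := fun T hT =>
    ⟨(LinearEquiv.ofInjectiveEndo (T : E →ₗ[ℝ] E) hT).toContinuousLinearEquiv, by ext x; rfl⟩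
  have hopen : ∀ᶠ x in 𝓝 a, fderiv ℝ f x ∈
      Set.range ((↑) : (E ≃L[ℝ] E) → E →L[ℝ] E) := by
    obtain ⟨T', hT'⟩ := equiv_of_injective _ hinj
    have hc : ContinuousAt (fderiv ℝ f) a := hf.fderiv.continuousAt
    exact hc.eventually (hT' ▸ ContinuousLinearEquiv.nhds T')
  obtain ⟨s, hs, hso, has⟩ := eventually_nhds_iff.1 (hopen.and hf.eventually_analyticAt)
  obtain ⟨T', hT'⟩ := (hs a has).1
  have hd : HasFDerivAt f (T' : E →L[ℝ] E) a := hT' ▸ hf.differentiableAt.hasFDerivAt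
  have hcd : ContDiffAt ℝ ω f a := hf.contDiffAt
  refine ⟨(hcd.toOpenPartialHomeomorph f hd (by simp)).restrOpen s hso, ?_, rfl, ?_, ?_⟩
  · exact ⟨hcd.mem_toOpenPartialHomeomorph_source hd (by simp), has⟩
  · exact fun x hx => (hs x hx.2).2
  · intro y hy
    set e := (hcd.toOpenPartialHomeomorph f hd (by simp)).restrOpen s hso
    have hx : e.symm y ∈ s := (e.map_target hy).2
    obtain ⟨T'', hT''⟩ := (hs _ hx).1
    refine ContDiffAt.analyticAt (e.contDiffAt_symm (f₀' := T'') hy ?_ ?_)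
    · rw [hT'']
      exact (hs _ hx).2.differentiableAt.hasFDerivAt
    · exact (hs _ hx).2.contDiffAt

end InverseFunction

/-- A regular zero curve of `lam`, with velocity any vector `w` that is annihilated by the
differential of `lam`. -/
theorem exists_zero_curve {lam : ℂ → ℝ} {p w η : ℂ} (hlam : AnalyticAt ℝ lam p)
    (h0 : lam p = 0) (hw : fderiv ℝ lam p w = 0) (hη : fderiv ℝ lam p η ≠ 0) :
    ∃ c : ℝ → ℂ, AnalyticAt ℝ c 0 ∧ c 0 = p ∧ HasDerivAt c w 0 ∧
      ∀ᶠ u in 𝓝 (0 : ℝ), lam (c u) = 0 := by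
  let L : ℝ × ℝ → ℂ := fun x => p + x.1 • w + x.2 • η
  have hL : ∀ x, HasFDerivAt L ((ContinuousLinearMap.fst ℝ ℝ ℝ).smulRight w +
      (ContinuousLinearMap.snd ℝ ℝ ℝ).smulRight η) x := fun x => by
    have h := ((hasFDerivAt_const p x).add
      ((ContinuousLinearMap.fst ℝ ℝ ℝ).smulRight w).hasFDerivAt).add
      ((ContinuousLinearMap.snd ℝ ℝ ℝ).smulRight η).hasFDerivAt
    rw [zero_add] at h
    exact h
  have hLa : AnalyticAt ℝ L 0 := by
    have h1 : AnalyticAt ℝ (fun x : ℝ × ℝ => x.1) 0 := analyticAt_fst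
    have h2 : AnalyticAt ℝ (fun x : ℝ × ℝ => x.2) 0 := analyticAt_snd
    exact (analyticAt_const.add (h1.smul analyticAt_const)).add (h2.smul analyticAt_const)
  have hL0 : L 0 = p := by simp [L]
  let M : ℝ × ℝ → ℝ × ℝ := fun x => (x.1, lam (L x))
  have hM : HasFDerivAt M ((ContinuousLinearMap.fst ℝ ℝ ℝ).prod
      ((fderiv ℝ lam p).comp ((ContinuousLinearMap.fst ℝ ℝ ℝ).smulRight w +
      (ContinuousLinearMap.snd ℝ ℝ ℝ).smulRight η))) 0 := by
    refine HasFDerivAt.prodMk hasFDerivAt_fst ?_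
    have h := hlam.differentiableAt.hasFDerivAt
    rw [← hL0] at h
    have := h.comp 0 (hL 0)
    rwa [hL0] at this
  have hMa : AnalyticAt ℝ M 0 := by
    refine AnalyticAt.prod analyticAt_fst ?_
    rw [← hL0] at hlam
    exact hlam.comp hLa
  have hM0 : M 0 = 0 := by
    simp [M, hL0, h0]
  have hMv : ∀ x : ℝ × ℝ, fderiv ℝ M 0 x = (x.1, x.2 * fderiv ℝ lam p η) := fun x => by
    rw [hM.fderiv]
    simp only [ContinuousLinearMap.prod_apply, ContinuousLinearMap.comp_apply, add_apply,
      ContinuousLinearMap.smulRight_apply, ContinuousLinearMap.coe_fst',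
      ContinuousLinearMap.coe_snd', map_add, map_smul, hw, smul_eq_mul, mul_zero, zero_add]
  have hinj : Function.Injective (fderiv ℝ M 0) := by
    rw [injective_iff_map_eq_zero]
    intro x hx
    rw [hMv] at hx
    simp only [Prod.mk_eq_zero, mul_eq_zero, hη, or_false] at hx
    exact Prod.ext hx.1 hx.2
  obtain ⟨e, h0e, heM, -, hsymm⟩ := exists_analytic_chart hMa hinj
  have h0t : (0 : ℝ × ℝ) ∈ e.target := by
    have := e.map_source h0e
    rwa [heM, hM0] at this
  have hs0 : e.symm 0 = 0 := by
    have := e.left_inv h0e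
    rwa [heM, hM0] at this
  have hia : AnalyticAt ℝ (fun u : ℝ => (u, (0 : ℝ))) 0 := analyticAt_id.prod analyticAt_const
  have hi : Filter.Tendsto (fun u : ℝ => (u, (0 : ℝ))) (𝓝 0) (𝓝 0) :=
    hia.continuousAt.tendsto
  have hMe : ∀ᶠ u in 𝓝 (0 : ℝ), M (e.symm (u, 0)) = (u, 0) := by
    filter_upwards [hi.eventually (e.open_target.mem_nhds h0t)] with u hu
    rw [← heM]
    exact e.right_inv hu
  have hγ : AnalyticAt ℝ (fun u : ℝ => e.symm (u, 0)) 0 :=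
    (hsymm 0 h0t).comp (f := fun u : ℝ => (u, (0 : ℝ))) (x := 0) hia
  have hγ0 : e.symm ((0 : ℝ), (0 : ℝ)) = 0 := hs0
  have hγ' : HasDerivAt (fun u : ℝ => e.symm (u, 0)) (1, 0) 0 := by
    have h1 := hγ.differentiableAt.hasDerivAt
    set v := deriv (fun u : ℝ => e.symm (u, 0)) 0 with hv
    have h2 : HasFDerivAt M (fderiv ℝ M 0) (e.symm ((0 : ℝ), (0 : ℝ))) := by
      rw [hγ0]; exact hMa.differentiableAt.hasFDerivAt
    have h3 := h2.comp_hasDerivAt (0 : ℝ) h1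
    have h4 : HasDerivAt (fun u : ℝ => (u, (0 : ℝ))) ((1 : ℝ), (0 : ℝ)) 0 :=
      (hasDerivAt_id 0).prodMk (hasDerivAt_const _ _)
    have h5 := (h4.congr_of_eventuallyEq hMe).unique h3
    rw [hMv] at h5
    have h6 : v = (1, 0) := by
      have e1 := congrArg Prod.fst h5
      have e2 := congrArg Prod.snd h5
      simp only at e1 e2
      refine Prod.ext e1.symm ?_
      simpa [hη] using e2.symm
    rwa [h6] at h1
  refine ⟨fun u => L (e.symm (u, 0)), ?_, ?_, ?_, ?_⟩
  · refine AnalyticAt.comp (g := L) ?_ hγ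
    rwa [hγ0]
  · simp only
    rw [hγ0, hL0]
  · have h := (hL (e.symm ((0 : ℝ), (0 : ℝ)))).comp_hasDerivAt (0 : ℝ) hγ'
    refine h.congr_deriv ?_
    simp
  · filter_upwards [hMe] with u hu
    exact congrArg Prod.snd hu

/-- The second and third derivative at `0` of a curve of the form `a (t²) + t³ b (t²)`. -/
theorem deriv_deriv_cusp {E : Type*} [NormedAddCommGroup E] [NormedSpace ℝ E] [CompleteSpace E]
    {a b q : ℝ → E} (ha : AnalyticAt ℝ a 0) (hb : AnalyticAt ℝ b 0)
    (hq : ∀ᶠ t in 𝓝 (0 : ℝ), q t = a (t ^ 2) + t ^ 3 • b (t ^ 2)) :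
    deriv (deriv q) 0 = (2 : ℝ) • deriv a 0 ∧ deriv (deriv (deriv q)) 0 = (6 : ℝ) • b 0 := by
  have hsq : Filter.Tendsto (fun t : ℝ => t ^ 2) (𝓝 0) (𝓝 0) := by
    have : Continuous fun t : ℝ => t ^ 2 := by fun_prop
    exact this.tendsto' _ _ (by simp)
  have comp : ∀ {f : ℝ → E}, AnalyticAt ℝ f 0 →
      ∀ᶠ t in 𝓝 (0 : ℝ), HasDerivAt (fun t => f (t ^ 2)) ((2 * t) • deriv f (t ^ 2)) t := by
    intro f hf
    filter_upwards [hsq.eventually hf.eventually_analyticAt] with t ht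
    have hp : HasDerivAt (fun t : ℝ => t ^ 2) (2 * t) t := by simpa using hasDerivAt_pow 2 t
    exact HasDerivAt.scomp (h := fun t : ℝ => t ^ 2) t ht.differentiableAt.hasDerivAt hp
  have hb1 := comp hb
  have hb2 := comp hb.deriv
  have d1 : deriv q =ᶠ[𝓝 0] fun t => t • ((2 : ℝ) • deriv a (t ^ 2)) +
      (t ^ 2 • ((3 : ℝ) • b (t ^ 2)) + t ^ 4 • ((2 : ℝ) • deriv b (t ^ 2))) := by
    filter_upwards [hq.eventually_nhds, comp ha, hb1] with t ht hat hbt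
    have h := hat.add ((hasDerivAt_pow 3 t).smul hbt)
    refine (h.congr_of_eventuallyEq ht).deriv.trans ?_
    simp only [smul_smul]
    module
  have d2 : deriv (deriv q) =ᶠ[𝓝 0] fun t => ((2 : ℝ) • deriv a (t ^ 2)) +
      (t ^ 2 • ((4 : ℝ) • deriv (deriv a) (t ^ 2)) + (t • ((6 : ℝ) • b (t ^ 2)) +
        (t ^ 3 • ((14 : ℝ) • deriv b (t ^ 2)) +
          t ^ 5 • ((4 : ℝ) • deriv (deriv b) (t ^ 2))))) := by
    filter_upwards [d1.eventually_nhds, comp ha.deriv, hb1, hb2] with t ht hat hbt hbt2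
    have h := ((hasDerivAt_id t).smul (hat.const_smul (2 : ℝ))).add
      (((hasDerivAt_pow 2 t).smul (hbt.const_smul (3 : ℝ))).add
        ((hasDerivAt_pow 4 t).smul (hbt2.const_smul (2 : ℝ))))
    refine (h.congr_of_eventuallyEq ht).deriv.trans ?_
    simp only [id, Pi.smul_apply, Nat.cast_ofNat, Nat.add_one_sub_one]
    module
  refine ⟨by simpa using d2.self_of_nhds, ?_⟩
  have hh := ((comp ha.deriv).self_of_nhds.const_smul (2 : ℝ)).add
    (((hasDerivAt_pow 2 (0 : ℝ)).smul ((comp ha.deriv.deriv).self_of_nhds.const_smul (4 : ℝ))).add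
    (((hasDerivAt_id (0 : ℝ)).smul (hb1.self_of_nhds.const_smul (6 : ℝ))).add
    (((hasDerivAt_pow 3 (0 : ℝ)).smul (hb2.self_of_nhds.const_smul (14 : ℝ))).add
      ((hasDerivAt_pow 5 (0 : ℝ)).smul
        ((comp hb.deriv.deriv).self_of_nhds.const_smul (4 : ℝ))))))
  refine (hh.congr_of_eventuallyEq d2).deriv.trans ?_
  simp

/-- Let `η` be a field that spans the kernel of `f'` along the regular curve `lam = 0` and is
transversal to that curve. If the velocity `f' w` of the singular curve and the second and third
derivatives of `f` along `η p` are independent, then `f` has a cuspidal edge. -/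
theorem hasCuspidalEdgeAt_of_transversal {f : ℂ → R3} {lam : ℂ → ℝ} {η : ℂ → ℂ} {p w : ℂ}
    (hf : AnalyticAt ℝ f p) (hlam : AnalyticAt ℝ lam p) (hη : AnalyticAt ℝ η p)
    (h0 : lam p = 0) (hw : fderiv ℝ lam p w = 0) (hηp : fderiv ℝ lam p (η p) ≠ 0)
    (hker : ∀ᶠ z in 𝓝 p, lam z = 0 → fderiv ℝ f z (η z) = 0)
    (hdet : det3 (fderiv ℝ f p w) (deriv (deriv fun t : ℝ => f (p + t • η p)) 0)
      (deriv (deriv (deriv fun t : ℝ => f (p + t • η p))) 0) ≠ 0) :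
    HasCuspidalEdgeAt f p := by
  obtain ⟨c, hca, hc0, hc', hcl⟩ := exists_zero_curve hlam h0 hw hηp
  have hηc : AnalyticAt ℝ (fun u => η (c u)) 0 := by
    rw [← hc0] at hη
    exact hη.comp hca
  -- the coordinates `(u, v) ↦ c u + v • η (c u)`
  let S : ℝ × ℝ → ℂ := fun x => c x.1 + x.2 • η (c x.1)
  have hS0 : S 0 = p := by simp [S, hc0]
  have hfst : AnalyticAt ℝ (fun x : ℝ × ℝ => x.1) 0 := analyticAt_fst
  have hsnd : AnalyticAt ℝ (fun x : ℝ × ℝ => x.2) 0 := analyticAt_snd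
  have hSa : AnalyticAt ℝ S 0 :=
    (AnalyticAt.comp (g := c) (f := fun x : ℝ × ℝ => x.1) (x := 0) hca hfst).add
      (hsnd.smul (AnalyticAt.comp (g := fun u => η (c u)) (f := fun x : ℝ × ℝ => x.1)
        (x := 0) hηc hfst))
  have hS1 : fderiv ℝ S 0 (1, 0) = w := by
    have h1 : HasDerivAt (fun u : ℝ => S (u, 0)) w 0 := by simpa [S] using hc'
    have h2 : HasDerivAt (fun u : ℝ => (u, (0 : ℝ))) ((1 : ℝ), (0 : ℝ)) 0 :=
      (hasDerivAt_id 0).prodMk (hasDerivAt_const _ _)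
    exact (HasFDerivAt.comp_hasDerivAt (0 : ℝ) (f := fun u : ℝ => (u, (0 : ℝ)))
      hSa.differentiableAt.hasFDerivAt h2).unique h1
  have hSv : ∀ u : ℝ, HasDerivAt (fun v : ℝ => S (u, v)) (η (c u)) 0 := fun u => by
    have h := ((hasDerivAt_id (0 : ℝ)).smul_const (η (c u))).const_add (c u)
    simpa [S] using h
  have hS2 : fderiv ℝ S 0 (0, 1) = η p := by
    have h1 := hSv 0
    rw [hc0] at h1
    have h2 : HasDerivAt (fun v : ℝ => ((0 : ℝ), v)) ((0 : ℝ), (1 : ℝ)) 0 :=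
      (hasDerivAt_const _ _).prodMk (hasDerivAt_id 0)
    exact (HasFDerivAt.comp_hasDerivAt (0 : ℝ) (f := fun v : ℝ => ((0 : ℝ), v))
      hSa.differentiableAt.hasFDerivAt h2).unique h1
  let F : ℝ × ℝ → R3 := fun x => f (S x)
  have hFa : AnalyticAt ℝ F 0 := AnalyticAt.comp (g := f) (f := S) (x := 0) (hS0 ▸ hf) hSa
  have hF' : ∀ᶠ u in 𝓝 (0 : ℝ), HasDerivAt (fun y => F (u, y)) 0 0 := by
    have hct : Filter.Tendsto c (𝓝 0) (𝓝 p) := hc0 ▸ hca.continuousAt.tendsto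
    filter_upwards [hcl, hct.eventually hker, hct.eventually hf.eventually_analyticAt]
      with u h1 h2 h3
    have hSu : S (u, 0) = c u := by simp [S]
    rw [← hSu] at h3
    have h := HasFDerivAt.comp_hasDerivAt (0 : ℝ) h3.differentiableAt.hasFDerivAt (hSv u)
    rw [hSu, h2 h1] at h
    exact h
  obtain ⟨A, B, hA, hB, hAB⟩ := exists_cusp_decomposition hFa hF'
  -- the inverse of the chart of the target
  let T : R3 → R3 := fun x => A (x 0, x 1) + x 2 • B (x 0, x 1)
  have hpr : ∀ j, AnalyticAt ℝ (fun x : R3 => x j) 0 := fun j =>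
    (ContinuousLinearMap.proj (R := ℝ) (φ := fun _ : Fin 3 => ℝ) j).analyticAt 0
  have h01 : AnalyticAt ℝ (fun x : R3 => (x 0, x 1)) 0 := (hpr 0).prod (hpr 1)
  have hTa : AnalyticAt ℝ T 0 :=
    (AnalyticAt.comp (g := A) (f := fun x : R3 => (x 0, x 1)) (x := 0) hA h01).add
      ((hpr 2).smul (AnalyticAt.comp (g := B) (f := fun x : R3 => (x 0, x 1)) (x := 0) hB h01))
  have hTd : ∀ x, fderiv ℝ T 0 x =
      x 0 • fderiv ℝ A 0 (1, 0) + x 1 • fderiv ℝ A 0 (0, 1) + x 2 • B 0 := by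
    intro x
    have hl : HasDerivAt (fun t : ℝ => t • x) x 0 := by
      simpa using (hasDerivAt_id (0 : ℝ)).smul_const x
    have hl2 : HasDerivAt (fun t : ℝ => (t * x 0, t * x 1)) (x 0, x 1) 0 := by
      have h1 := ((hasDerivAt_id (0 : ℝ)).mul_const (x 0)).prodMk
        ((hasDerivAt_id (0 : ℝ)).mul_const (x 1))
      simpa using h1
    have hz : ((0 : ℝ) * x 0, (0 : ℝ) * x 1) = 0 := by simp
    have hA' : HasFDerivAt A (fderiv ℝ A 0) ((0 : ℝ) * x 0, (0 : ℝ) * x 1) := by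
      rw [hz]; exact hA.differentiableAt.hasFDerivAt
    have hB' : HasFDerivAt B (fderiv ℝ B 0) ((0 : ℝ) * x 0, (0 : ℝ) * x 1) := by
      rw [hz]; exact hB.differentiableAt.hasFDerivAt
    have h3 := (hA'.comp_hasDerivAt (0 : ℝ) hl2).add
      (((hasDerivAt_id (0 : ℝ)).mul_const (x 2)).smul (hB'.comp_hasDerivAt (0 : ℝ) hl2))
    have h4 : HasDerivAt (fun t : ℝ => T (t • x)) (fderiv ℝ T 0 x) 0 := by
      have h0 : HasFDerivAt T (fderiv ℝ T 0) ((0 : ℝ) • x) := by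
        rw [zero_smul]; exact hTa.differentiableAt.hasFDerivAt
      exact h0.comp_hasDerivAt (0 : ℝ) hl
    refine (h4.unique h3).trans ?_
    have hx : ((x 0, x 1) : ℝ × ℝ) = x 0 • ((1 : ℝ), (0 : ℝ)) + x 1 • ((0 : ℝ), (1 : ℝ)) := by
      ext <;> simp
    simp only [Function.comp_apply, id, hz]
    rw [hx, map_add, map_smul, map_smul]
    simp
  -- the columns of the derivative of `T` in terms of `f`
  have hcol0 : fderiv ℝ A 0 (1, 0) = fderiv ℝ f p w := by
    have h2 : HasDerivAt (fun u : ℝ => (u, (0 : ℝ))) ((1 : ℝ), (0 : ℝ)) 0 :=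
      (hasDerivAt_id 0).prodMk (hasDerivAt_const _ _)
    have h3 := HasFDerivAt.comp_hasDerivAt (0 : ℝ) (f := fun u : ℝ => (u, (0 : ℝ)))
      hA.differentiableAt.hasFDerivAt h2
    have h4 : HasDerivAt (fun u : ℝ => F (u, 0)) (fderiv ℝ f p w) 0 := by
      have hfS : HasFDerivAt f (fderiv ℝ f p) (S ((0 : ℝ), (0 : ℝ))) := by
        have : S ((0 : ℝ), (0 : ℝ)) = p := hS0
        rw [this]; exact hf.differentiableAt.hasFDerivAt
      have h1 : HasDerivAt (fun u : ℝ => S (u, 0)) w 0 := by simpa [S] using hc'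
      exact hfS.comp_hasDerivAt (0 : ℝ) h1
    have hi : Filter.Tendsto (fun u : ℝ => (u, (0 : ℝ))) (𝓝 0) (𝓝 0) := by
      have : Continuous fun u : ℝ => (u, (0 : ℝ)) := by fun_prop
      exact this.tendsto' _ _ (by simp)
    refine HasDerivAt.unique (f := fun u : ℝ => A (u, 0)) h3 (h4.congr_of_eventuallyEq ?_)
    filter_upwards [hi.eventually hAB] with u hu
    simpa using hu.symm
  have hi2a : AnalyticAt ℝ (fun v : ℝ => ((0 : ℝ), v)) 0 := analyticAt_const.prod analyticAt_id
  have hcols := deriv_deriv_cusp (q := fun t : ℝ => f (p + t • η p))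
    (AnalyticAt.comp (g := A) (f := fun v : ℝ => ((0 : ℝ), v)) (x := 0) hA hi2a)
    (AnalyticAt.comp (g := B) (f := fun v : ℝ => ((0 : ℝ), v)) (x := 0) hB hi2a) (by
      filter_upwards [hi2a.continuousAt.tendsto.eventually hAB] with t ht
      simpa [F, S, hc0] using ht)
  have hcol1 : deriv (A ∘ fun v : ℝ => ((0 : ℝ), v)) 0 = fderiv ℝ A 0 (0, 1) := by
    have h2 : HasDerivAt (fun v : ℝ => ((0 : ℝ), v)) ((0 : ℝ), (1 : ℝ)) 0 :=
      (hasDerivAt_const _ _).prodMk (hasDerivAt_id 0)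
    exact (HasFDerivAt.comp_hasDerivAt (0 : ℝ) (f := fun u : ℝ => ((0 : ℝ), u))
      hA.differentiableAt.hasFDerivAt h2).deriv
  have hTinj : Function.Injective (fderiv ℝ T 0) := by
    rw [injective_iff_map_eq_zero]
    intro x hx
    rw [hcols.1, hcols.2, hcol1, ← hcol0] at hdet
    rw [hTd] at hx
    have hB0 : (B ∘ fun v : ℝ => ((0 : ℝ), v)) 0 = B 0 := rfl
    rw [hB0] at hdet
    generalize fderiv ℝ A 0 (1, 0) = a at *
    generalize fderiv ℝ A 0 (0, 1) = b at *
    generalize B 0 = d at *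
    have e0 := congrFun hx 0
    have e1 := congrFun hx 1
    have e2 := congrFun hx 2
    simp only [Pi.add_apply, Pi.smul_apply, smul_eq_mul, Pi.zero_apply] at e0 e1 e2
    simp only [det3, Matrix.det_fin_three, Matrix.of_apply, Matrix.cons_val_zero,
      Matrix.cons_val_one, Matrix.cons_val, Pi.smul_apply, smul_eq_mul] at hdet
    -- Cramer's rule
    have hD : (a 0 * (b 1 * d 2 - b 2 * d 1) - a 1 * (b 0 * d 2 - b 2 * d 0)
        + a 2 * (b 0 * d 1 - b 1 * d 0)) ≠ 0 := by
      intro h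
      apply hdet
      linear_combination 12 * h
    funext j
    apply mul_left_cancel₀ hD
    rw [Pi.zero_apply, mul_zero]
    fin_cases j
    · simp only [Fin.zero_eta]
      linear_combination (b 1 * d 2 - b 2 * d 1) * e0 - (b 0 * d 2 - b 2 * d 0) * e1
        + (b 0 * d 1 - b 1 * d 0) * e2
    · simp only [Fin.mk_one]
      linear_combination (a 2 * d 1 - a 1 * d 2) * e0 - (a 2 * d 0 - a 0 * d 2) * e1
        + (a 1 * d 0 - a 0 * d 1) * e2
    · simp only [Fin.reduceFinMk]
      linear_combination (a 1 * b 2 - a 2 * b 1) * e0 - (a 0 * b 2 - a 2 * b 0) * e1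
        + (a 0 * b 1 - a 1 * b 0) * e2
  obtain ⟨e, h0e, heT, heA, hesA⟩ := exists_analytic_chart hTa hTinj
  -- the chart of the source, on the complex plane
  let Sc : ℂ → ℂ := fun z => S (z.re, z.im)
  let ri : ℂ →L[ℝ] ℝ × ℝ := Complex.reCLM.prod Complex.imCLM
  have hri0 : ri 0 = 0 := map_zero ri
  have hSca : AnalyticAt ℝ Sc 0 :=
    AnalyticAt.comp (g := S) (f := ri) (x := 0) (by rwa [hri0]) (ri.analyticAt 0)
  have hScd : ∀ z : ℂ, fderiv ℝ Sc 0 z = z.re • w + z.im • η p := by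
    intro z
    have h : HasFDerivAt S (fderiv ℝ S 0) (ri 0) := by
      rw [hri0]; exact hSa.differentiableAt.hasFDerivAt
    have h2 : fderiv ℝ Sc 0 = (fderiv ℝ S 0).comp ri := (h.comp (0 : ℂ) ri.hasFDerivAt).fderiv
    have hz : ri z = z.re • ((1 : ℝ), (0 : ℝ)) + z.im • ((0 : ℝ), (1 : ℝ)) := by
      ext <;> simp [ri]
    rw [h2, ContinuousLinearMap.comp_apply, hz, map_add, map_smul, map_smul, hS1, hS2]
  have hw0 : fderiv ℝ f p w ≠ 0 := by
    intro h
    apply hdet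
    rw [h]
    simp [det3, Matrix.det_fin_three]
  have hSinj : Function.Injective (fderiv ℝ Sc 0) := by
    rw [injective_iff_map_eq_zero]
    intro z hz
    rw [hScd] at hz
    have h1 := congrArg (fderiv ℝ lam p) hz
    simp only [map_add, map_smul, hw, map_zero, smul_eq_mul, mul_zero, zero_add, mul_eq_zero,
      hηp, or_false] at h1
    rw [h1, zero_smul, add_zero, smul_eq_zero] at hz
    rcases hz with hz | hz
    · exact Complex.ext hz h1
    · rw [hz, map_zero] at hw0
      exact absurd rfl hw0
  obtain ⟨σ, h0σ, hσ, hσA, hσsA⟩ := exists_analytic_chart hSca hSinj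
  have hstd : Filter.Tendsto standardCuspidalEdge (𝓝 0) (𝓝 0) := by
    have : Continuous standardCuspidalEdge := by
      refine continuous_pi fun j => ?_
      fin_cases j <;> simp only [standardCuspidalEdge] <;> simp <;> fun_prop
    refine this.tendsto' _ _ ?_
    funext j
    fin_cases j <;> simp [standardCuspidalEdge]
  have hfT : ∀ᶠ z in 𝓝 (0 : ℂ), f (Sc z) = T (standardCuspidalEdge z) := by
    have ht : Filter.Tendsto (fun z => ri z) (𝓝 0) (𝓝 0) := by
      have := ri.continuous.tendsto 0
      rwa [hri0] at this
    filter_upwards [ht.eventually hAB] with z hz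
    have : F (ri z) = f (Sc z) := rfl
    rw [← this, hz]
    simp [T, ri, standardCuspidalEdge]
  have hstd0 : standardCuspidalEdge 0 = 0 := by
    funext j
    fin_cases j <;> simp [standardCuspidalEdge]
  have hSc0 : Sc 0 = p := hS0
  have hT0 : T 0 = f p := by
    have := hfT.self_of_nhds
    rw [hSc0, hstd0] at this
    exact this.symm
  refine ⟨σ, e.symm, ⟨h0σ, by rw [hσ, hSc0], ?_, ?_⟩, ⟨?_, ?_, ?_, ?_⟩, ?_⟩
  · rw [hσ]
    exact fun x hx => (hσA x hx).contDiffAt.contDiffWithinAt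
  · exact fun x hx => (hσsA x hx).contDiffAt.contDiffWithinAt
  · have := e.map_source h0e
    rwa [heT, hT0] at this
  · rw [← hT0, ← heT]
    exact e.left_inv h0e
  · exact fun x hx => (hesA x hx).contDiffAt.contDiffWithinAt
  · rw [OpenPartialHomeomorph.symm_symm, heT]
    exact fun x hx => (heA x hx).contDiffAt.contDiffWithinAt
  · filter_upwards [hfT, hstd.eventually (e.open_source.mem_nhds h0e)] with z hz hzs
    rw [hσ, hz, ← heT]
    exact ⟨e.map_source hzs, e.left_inv hzs⟩

/-! ### A necessary condition for cuspidal edges -/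

/-- The derivatives of a smooth chart and of its inverse are inverse to each other. -/
theorem fderiv_symm_comp_fderiv {E F : Type*} [NormedAddCommGroup E] [NormedSpace ℝ E]
    [NormedAddCommGroup F] [NormedSpace ℝ F] (e : OpenPartialHomeomorph E F)
    (he : ContDiffOn ℝ ∞ e e.source) (he' : ContDiffOn ℝ ∞ e.symm e.target) {x : E}
    (hx : x ∈ e.source) :
    HasFDerivAt e (fderiv ℝ e x) x ∧
      (fderiv ℝ e.symm (e x)).comp (fderiv ℝ e x) = ContinuousLinearMap.id ℝ E ∧
      (fderiv ℝ e x).comp (fderiv ℝ e.symm (e x)) = ContinuousLinearMap.id ℝ F := by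
  have h1 : HasFDerivAt e (fderiv ℝ e x) x :=
    ((he.contDiffAt (e.open_source.mem_nhds hx)).differentiableAt (by simp)).hasFDerivAt
  have h2 : HasFDerivAt e.symm (fderiv ℝ e.symm (e x)) (e x) :=
    ((he'.contDiffAt (e.open_target.mem_nhds (e.map_source hx))).differentiableAt
      (by simp)).hasFDerivAt
  refine ⟨h1, (h2.comp x h1).unique ?_, ?_⟩
  · exact (hasFDerivAt_id x).congr_of_eventuallyEq (e.eventually_left_inverse hx)
  · have h1' : HasFDerivAt e (fderiv ℝ e x) (e.symm (e x)) := by rwa [e.left_inv hx]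
    exact (h1'.comp (e x) h2).unique
      ((hasFDerivAt_id (e x)).congr_of_eventuallyEq
        (e.eventually_right_inverse (e.map_source hx)))

theorem hasFDerivAt_standardCuspidalEdge (w : ℂ) : ∃ D : ℂ →L[ℝ] R3,
    HasFDerivAt standardCuspidalEdge D w ∧
      ∀ v, D v = ![v.re, 2 * w.im * v.im, 3 * w.im ^ 2 * v.im] := by
  have him : HasFDerivAt (fun z : ℂ => z.im) Complex.imCLM w := Complex.imCLM.hasFDerivAt
  refine ⟨ContinuousLinearMap.pi ![Complex.reCLM, (2 * w.im) • Complex.imCLM,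
    (3 * w.im ^ 2) • Complex.imCLM], hasFDerivAt_pi.2 fun j => ?_, fun v => ?_⟩
  · fin_cases j
    · exact Complex.reCLM.hasFDerivAt
    · simpa [standardCuspidalEdge] using him.pow 2
    · simpa [standardCuspidalEdge] using him.pow 3
  · funext j
    fin_cases j <;> simp

/-- At a cuspidal edge that is a regular point of a function `lam` vanishing on the singular set,
the kernel of `f'` is transversal to the singular curve. -/
theorem transversal_of_hasCuspidalEdgeAt {f : ℂ → R3} {lam : ℂ → ℝ} {p η : ℂ}
    (hcusp : HasCuspidalEdgeAt f p) (hf : ∀ᶠ z in 𝓝 p, DifferentiableAt ℝ f z)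
    (hlam : DifferentiableAt ℝ lam p)
    (hsing : ∀ᶠ z in 𝓝 p, ¬ Function.Injective (fderiv ℝ f z) → lam z = 0)
    (hdl : fderiv ℝ lam p ≠ 0) (hη : η ≠ 0) (hker : fderiv ℝ f p η = 0) :
    fderiv ℝ lam p η ≠ 0 := by
  obtain ⟨σ, Θ, ⟨hσ0, hσp, hσ, hσ'⟩, ⟨hΘp, hΘ0, hΘ, hΘ'⟩, hev⟩ := hcusp
  have hσt : Filter.Tendsto σ (𝓝 0) (𝓝 p) := by
    have := σ.continuousAt hσ0
    rwa [ContinuousAt, hσp] at this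
  -- the chain rule, with the derivatives of the charts inverted
  have hchain : ∀ᶠ w in 𝓝 (0 : ℂ), ∀ v,
      (fderiv ℝ f (σ w) (fderiv ℝ σ w v) = 0 ↔
        v.re = 0 ∧ 2 * w.im * v.im = 0 ∧ 3 * w.im ^ 2 * v.im = 0) := by
    filter_upwards [hev.eventually_nhds, hσt.eventually hf, σ.open_source.mem_nhds hσ0]
      with w hw hfw hws v
    obtain ⟨hs1, -, -⟩ := fderiv_symm_comp_fderiv σ hσ hσ' hws
    obtain ⟨ht1, ht2, -⟩ := fderiv_symm_comp_fderiv Θ hΘ hΘ' hw.self_of_nhds.1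
    obtain ⟨D, hD, hDv⟩ := hasFDerivAt_standardCuspidalEdge w
    have h1 := HasFDerivAt.comp w (g := fun z => Θ (f z)) (ht1.comp (σ w) hfw.hasFDerivAt) hs1
    have h2 := (h1.congr_of_eventuallyEq (f₁ := standardCuspidalEdge)
      (hw.mono fun z hz => hz.2.symm)).unique hD
    have h3 : D v = fderiv ℝ Θ (f (σ w)) (fderiv ℝ f (σ w) (fderiv ℝ σ w v)) := by
      rw [← h2]; rfl
    have h4 : D v = 0 ↔ v.re = 0 ∧ 2 * w.im * v.im = 0 ∧ 3 * w.im ^ 2 * v.im = 0 := by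
      rw [hDv, funext_iff, Fin.forall_fin_succ, Fin.forall_fin_two]
      rfl
    rw [← h4, h3]
    refine ⟨fun h => by rw [h, map_zero], fun h => ?_⟩
    have h5 := congrArg (fderiv ℝ Θ.symm (Θ (f (σ w)))) h
    rw [map_zero, ← ContinuousLinearMap.comp_apply, ht2] at h5
    exact h5
  have hinj : ∀ᶠ w in 𝓝 (0 : ℂ), Function.Injective (fderiv ℝ σ w) := by
    filter_upwards [σ.open_source.mem_nhds hσ0] with w hws
    obtain ⟨-, h2, -⟩ := fderiv_symm_comp_fderiv σ hσ hσ' hws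
    exact Function.LeftInverse.injective (g := fderiv ℝ σ.symm (σ w)) fun x =>
      congrArg (fun T : ℂ →L[ℝ] ℂ => T x) h2
  -- `lam` vanishes on the image of the real axis
  have hreal : Filter.Tendsto (fun u : ℝ => (u : ℂ)) (𝓝 0) (𝓝 0) :=
    Complex.continuous_ofReal.tendsto' _ _ (by simp)
  have hzero : ∀ᶠ u : ℝ in 𝓝 0, lam (σ u) = 0 := by
    filter_upwards [hreal.eventually hchain, hreal.eventually hinj,
      hreal.eventually (hσt.eventually hsing)] with u h1 h2 h3
    refine h3 fun h => ?_
    have h4 := (h1 Complex.I).2 (by simp)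
    have h5 : fderiv ℝ σ u Complex.I = 0 := by
      rw [← map_zero (fderiv ℝ f (σ u))] at h4
      exact h h4
    rw [← map_zero (fderiv ℝ σ u)] at h5
    exact Complex.I_ne_zero (h2 h5)
  obtain ⟨hs1, -, hs3⟩ := fderiv_symm_comp_fderiv σ hσ hσ' hσ0
  have hone : fderiv ℝ lam p (fderiv ℝ σ 0 1) = 0 := by
    have hl : HasFDerivAt lam (fderiv ℝ lam p) (σ ((0 : ℝ) : ℂ)) := by
      rw [Complex.ofReal_zero, hσp]; exact hlam.hasFDerivAt
    have hs1' : HasFDerivAt σ (fderiv ℝ σ 0) ((0 : ℝ) : ℂ) := by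
      rwa [Complex.ofReal_zero]
    have h := hl.comp_hasDerivAt (0 : ℝ) (hs1'.comp_hasDerivAt (0 : ℝ)
      Complex.ofRealCLM.hasDerivAt)
    have h0 : HasDerivAt (fun _ : ℝ => (0 : ℝ)) 0 0 := hasDerivAt_const _ _
    have := h.unique (h0.congr_of_eventuallyEq hzero)
    simpa using this
  have hsurj : ∀ x, fderiv ℝ σ 0 (fderiv ℝ σ.symm (σ 0) x) = x := fun x =>
    congrArg (fun T : ℂ →L[ℝ] ℂ => T x) hs3
  have hdecomp : ∀ v : ℂ, fderiv ℝ lam p (fderiv ℝ σ 0 v) =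
      v.im * fderiv ℝ lam p (fderiv ℝ σ 0 Complex.I) := fun v => by
    have hv : v = v.re • (1 : ℂ) + v.im • Complex.I := by
      apply Complex.ext <;> simp
    conv_lhs => rw [hv]
    rw [map_add, map_smul, map_smul, map_add, map_smul, map_smul, hone]
    simp
  -- `η` corresponds to a multiple of the second coordinate field
  obtain ⟨v, rfl⟩ : ∃ v, fderiv ℝ σ 0 v = η := ⟨_, hsurj η⟩
  have h1 := hchain.self_of_nhds v
  rw [hσp] at h1
  have hre := (h1.1 hker).1
  intro h
  rw [hdecomp, mul_eq_zero] at h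
  rcases h with h | h
  · apply hη
    rw [show v = 0 from Complex.ext hre h, map_zero]
  · apply hdl
    ext1 x
    rw [← hsurj x, hdecomp, h]
    simp

/-! ### Affine maximal maps as fronts -/

section VectorAlgebra

theorem det3_eq (a b c : R3) : det3 a b c = a 0 * b 1 * c 2 - a 0 * b 2 * c 1 - a 1 * b 0 * c 2
    + a 1 * b 2 * c 0 + a 2 * b 0 * c 1 - a 2 * b 1 * c 0 := by
  simp [det3, Matrix.det_fin_three]

theorem dot_eq (a b : R3) : a ⬝ᵥ b = a 0 * b 0 + a 1 * b 1 + a 2 * b 2 := by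
  simp [dotProduct, Fin.sum_univ_three]

theorem cross_eq (a b : R3) : crossProduct a b =
    ![a 1 * b 2 - a 2 * b 1, a 2 * b 0 - a 0 * b 2, a 0 * b 1 - a 1 * b 0] := by
  rw [cross_apply]

/-- Expansion of `n` in the basis `a`, `b`, `a × b`, where `a` and `b` are orthogonal and of the
same length, in the case that the last component vanishes. -/
theorem expand_of_det_eq_zero {n a b : R3} (hE : a ⬝ᵥ a = b ⬝ᵥ b) (hF : a ⬝ᵥ b = 0)
    (h0 : a ⬝ᵥ a ≠ 0) (hdet : det3 n a b = 0) :
    (n ⬝ᵥ a) • a + (n ⬝ᵥ b) • b = (a ⬝ᵥ a) • n := by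
  rw [det3_eq] at hdet
  have key : ∀ j, (a ⬝ᵥ a) * ((n ⬝ᵥ a) * a j + (n ⬝ᵥ b) * b j) =
      (a ⬝ᵥ a) * ((a ⬝ᵥ a) * n j) := by
    intro j
    simp only [dot_eq] at hE hF h0 ⊢
    have hG : b 0 * b 0 + b 1 * b 1 + b 2 * b 2 = a 0 * a 0 + a 1 * a 1 + a 2 * a 2 := hE.symm
    generalize hE' : a 0 * a 0 + a 1 * a 1 + a 2 * a 2 = e at *
    have id0 : ∀ j, (![a 1 * b 2 - a 2 * b 1, a 2 * b 0 - a 0 * b 2,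
          a 0 * b 1 - a 1 * b 0] j) *
        (n 0 * a 1 * b 2 - n 0 * a 2 * b 1 - n 1 * a 0 * b 2
          + n 1 * a 2 * b 0 + n 2 * a 0 * b 1 - n 2 * a 1 * b 0) =
        ((a 0 * a 0 + a 1 * a 1 + a 2 * a 2) * (b 0 * b 0 + b 1 * b 1 + b 2 * b 2)
          - (a 0 * b 0 + a 1 * b 1 + a 2 * b 2) ^ 2) * n j
        - ((n 0 * a 0 + n 1 * a 1 + n 2 * a 2) * (b 0 * b 0 + b 1 * b 1 + b 2 * b 2)
          - (n 0 * b 0 + n 1 * b 1 + n 2 * b 2) * (a 0 * b 0 + a 1 * b 1 + a 2 * b 2)) * a j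
        - ((n 0 * b 0 + n 1 * b 1 + n 2 * b 2) * (a 0 * a 0 + a 1 * a 1 + a 2 * a 2)
          - (n 0 * a 0 + n 1 * a 1 + n 2 * a 2) * (a 0 * b 0 + a 1 * b 1 + a 2 * b 2)) * b j := by
      intro j
      fin_cases j <;> simp <;> ring
    have h := id0 j
    rw [hdet, hF, hG, hE'] at h
    linear_combination h
  funext j
  exact mul_left_cancel₀ h0 (key j)

theorem cross_self_smul (n : R3) (r : ℝ) : crossProduct n (r • n) = 0 := by
  rw [map_smul, cross_self, smul_zero]

theorem det3_cross_cross (n a b m : R3) :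
    det3 (crossProduct n b) (-crossProduct n a) m = det3 n a b * (n ⬝ᵥ m) := by
  simp only [det3_eq, dot_eq, cross_eq]
  simp
  ring

theorem eq_zero_of_cross_eq_zero {n a b : R3} (hdet : det3 n a b ≠ 0) {x y : ℝ}
    (h : crossProduct n (x • a + y • b) = 0) : x = 0 ∧ y = 0 := by
  rw [cross_eq] at h
  have h0 := congrFun h 0
  have h1 := congrFun h 1
  have h2 := congrFun h 2
  simp at h0 h1 h2
  rw [det3_eq] at hdet
  constructor
  · refine (mul_eq_zero.1 (?_ : x * _ = 0)).resolve_right hdet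
    linear_combination b 0 * h0 + b 1 * h1 + b 2 * h2
  · refine (mul_eq_zero.1 (?_ : y * _ = 0)).resolve_right hdet
    linear_combination -(a 0 * h0 + a 1 * h1 + a 2 * h2)

/-- The determinant of the velocity of the singular curve and of the second and third derivative
along the null direction: `n` is the conormal, `a` its derivative in the null direction and
`e • n` its derivative in the rotated null direction, `m'` the derivative of the latter. -/
theorem det3_null_derivatives (n a m' n'' m'' : R3) (e x y : ℝ) :
    det3 (crossProduct n (x • e • n + y • a))
      (crossProduct a (e • n) + crossProduct n m')
      ((crossProduct n'' (e • n) + crossProduct a m') +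
        (crossProduct a m' + crossProduct n m'')) = 2 * y * det3 n a m' ^ 2 := by
  simp only [det3_eq, cross_eq]
  simp
  ring

theorem hasDerivAt_cross {f g : ℝ → R3} {f' g' : R3} {t : ℝ} (hf : HasDerivAt f f' t)
    (hg : HasDerivAt g g' t) : HasDerivAt (fun t => crossProduct (f t) (g t))
      (crossProduct f' (g t) + crossProduct (f t) g') t := by
  have hf' := hasDerivAt_pi.1 hf
  have hg' := hasDerivAt_pi.1 hg
  simp only [cross_eq]
  refine hasDerivAt_pi.2 fun j => ?_
  fin_cases j
  · refine (((hf' 1).mul (hg' 2)).sub ((hf' 2).mul (hg' 1))).congr_deriv ?_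
    simp; ring
  · refine (((hf' 2).mul (hg' 0)).sub ((hf' 0).mul (hg' 2))).congr_deriv ?_
    simp; ring
  · refine (((hf' 0).mul (hg' 1)).sub ((hf' 1).mul (hg' 0))).congr_deriv ?_
    simp; ring

theorem hasDerivAt_det3 {f g h : ℝ → R3} {f' g' h' : R3} {t : ℝ} (hf : HasDerivAt f f' t)
    (hg : HasDerivAt g g' t) (hh : HasDerivAt h h' t) :
    HasDerivAt (fun t => det3 (f t) (g t) (h t))
      (det3 f' (g t) (h t) + det3 (f t) g' (h t) +
        det3 (f t) (g t) h') t := by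
  have hf := hasDerivAt_pi.1 hf
  have hg := hasDerivAt_pi.1 hg
  have hh := hasDerivAt_pi.1 hh
  simp only [det3_eq]
  refine ((((((((hf 0).mul (hg 1)).mul (hh 2)).sub (((hf 0).mul (hg 2)).mul (hh 1))).sub
    (((hf 1).mul (hg 0)).mul (hh 2))).add (((hf 1).mul (hg 2)).mul (hh 0))).add
    (((hf 2).mul (hg 0)).mul (hh 1))).sub (((hf 2).mul (hg 1)).mul (hh 0))).congr_deriv ?_
  simp only [Pi.mul_apply]
  ring

end VectorAlgebra

/-- The density `[N, N_u, N_v]` of the map `N`; it is the identifier of the singularities of a map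
with conormal map `N`, up to a factor. -/
noncomputable def conormalDet (N : ℂ → R3) (z : ℂ) : ℝ :=
  det3 (N z) (partialU N z) (partialV N z)

/-- The field `(N · N_v) - i (N · N_u)`, which spans the kernel of the differential of a map with
conormal map `N` along the singular set. -/
noncomputable def nullField (N : ℂ → R3) (z : ℂ) : ℂ :=
  ((N z ⬝ᵥ partialV N z : ℝ) : ℂ) - ((N z ⬝ᵥ partialU N z : ℝ) : ℂ) * Complex.I

theorem fderiv_eq_partial (f : ℂ → R3) (z v : ℂ) :
    fderiv ℝ f z v = v.re • partialU f z + v.im • partialV f z := by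
  have hv : v = v.re • (1 : ℂ) + v.im • Complex.I := by apply Complex.ext <;> simp
  conv_lhs => rw [hv]
  rw [map_add, map_smul, map_smul]
  rfl

section Analytic

variable {N : ℂ → R3} {p : ℂ}

theorem analyticAt_fderiv_apply (hN : AnalyticAt ℝ N p) (v : ℂ) :
    AnalyticAt ℝ (fun z => fderiv ℝ N z v) p :=
  ((ContinuousLinearMap.apply ℝ R3 v).analyticAt _).comp hN.fderiv

theorem analyticAt_coord {f : ℂ → R3} (hf : AnalyticAt ℝ f p) (j : Fin 3) :
    AnalyticAt ℝ (fun z => f z j) p :=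
  ((ContinuousLinearMap.proj (R := ℝ) (φ := fun _ : Fin 3 => ℝ) j).analyticAt _).comp hf

theorem analyticAt_conormalDet (hN : AnalyticAt ℝ N p) : AnalyticAt ℝ (conormalDet N) p := by
  have h0 := analyticAt_coord hN
  have h1 := analyticAt_coord (analyticAt_fderiv_apply hN 1)
  have h2 := analyticAt_coord (analyticAt_fderiv_apply hN Complex.I)
  have : conormalDet N = fun z => _ := funext fun z => det3_eq _ _ _
  rw [this]
  simp only [partialU, partialV]
  exact ((((((((h0 0).mul (h1 1)).mul (h2 2)).sub (((h0 0).mul (h1 2)).mul (h2 1))).sub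
    (((h0 1).mul (h1 0)).mul (h2 2))).add (((h0 1).mul (h1 2)).mul (h2 0))).add
    (((h0 2).mul (h1 0)).mul (h2 1))).sub (((h0 2).mul (h1 1)).mul (h2 0)))

theorem analyticAt_nullField (hN : AnalyticAt ℝ N p) : AnalyticAt ℝ (nullField N) p := by
  have h0 := analyticAt_coord hN
  have hd : ∀ v, AnalyticAt ℝ (fun z => ((N z ⬝ᵥ fderiv ℝ N z v : ℝ) : ℂ)) p := fun v => by
    have h1 := analyticAt_coord (analyticAt_fderiv_apply hN v)
    have : AnalyticAt ℝ (fun z => N z ⬝ᵥ fderiv ℝ N z v) p := by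
      simp only [dot_eq]
      exact (((h0 0).mul (h1 0)).add ((h0 1).mul (h1 1))).add ((h0 2).mul (h1 2))
    exact (Complex.ofRealCLM.analyticAt _).comp this
  exact (hd Complex.I).sub ((hd 1).mul analyticAt_const)

end Analytic

section Front

variable {ψ N : ℂ → R3} {z : ℂ}

/-- The singular points are zeros of the conormal determinant. -/
theorem injective_fderiv_of_conormalDet_ne_zero
    (hdψ : ∀ v, fderiv ℝ ψ z v = crossProduct (N z) (fderiv ℝ N z (Complex.I * v)))
    (h : conormalDet N z ≠ 0) : Function.Injective (fderiv ℝ ψ z) := by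
  rw [injective_iff_map_eq_zero]
  intro v hv
  rw [hdψ, fderiv_eq_partial] at hv
  obtain ⟨h1, h2⟩ := eq_zero_of_cross_eq_zero h hv
  apply Complex.ext
  · simpa using h2
  · simpa using h1

/-- On the singular set the vector `N` is tangent to the surface `N`, and `N'` maps the rotated null
field to a multiple of `N`. -/
theorem fderiv_I_mul_nullField
    (hE : partialU N z ⬝ᵥ partialU N z = partialV N z ⬝ᵥ partialV N z)
    (hF : partialU N z ⬝ᵥ partialV N z = 0) (h0 : partialU N z ⬝ᵥ partialU N z ≠ 0)
    (h : conormalDet N z = 0) :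
    fderiv ℝ N z (Complex.I * nullField N z) = (partialU N z ⬝ᵥ partialU N z) • N z := by
  rw [← expand_of_det_eq_zero hE hF h0 h, fderiv_eq_partial]
  simp [nullField]

theorem singularityIdentifier_eq {n : ℂ → R3}
    (hdψ : ∀ v, fderiv ℝ ψ z v = crossProduct (N z) (fderiv ℝ N z (Complex.I * v))) :
    singularityIdentifier ψ n z = conormalDet N z * (N z ⬝ᵥ n z) := by
  have h2 : partialV ψ z = -crossProduct (N z) (partialU N z) := by
    rw [partialV, hdψ, Complex.I_mul_I, map_neg, map_neg]
    rfl
  have h1 : partialU ψ z = crossProduct (N z) (partialV N z) := by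
    rw [partialU, hdψ, mul_one]
    rfl
  rw [singularityIdentifier, h1, h2, det3_cross_cross, conormalDet]

/-- A map with conormal map `N` has a cuspidal edge at a regular point of its singular set exactly
if the null direction is transversal to the singular set there. It is automatically a front: the
derivative of `N` in the null direction is orthogonal to `N`, since `N` is conformal. -/
theorem hasCuspidalEdgeAt_iff_transversal {p : ℂ} (hψ : AnalyticAt ℝ ψ p)
    (hN : AnalyticAt ℝ N p)
    (hdψ : ∀ᶠ z in 𝓝 p, ∀ v,
      fderiv ℝ ψ z v = crossProduct (N z) (fderiv ℝ N z (Complex.I * v)))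
    (hconf : ∀ᶠ z in 𝓝 p, partialU N z ⬝ᵥ partialU N z = partialV N z ⬝ᵥ partialV N z ∧
      partialU N z ⬝ᵥ partialV N z = 0 ∧ partialU N z ⬝ᵥ partialU N z ≠ 0)
    (hp : conormalDet N p = 0) (hNp : N p ≠ 0) (hd : fderiv ℝ (conormalDet N) p ≠ 0) :
    HasCuspidalEdgeAt ψ p ↔ fderiv ℝ (conormalDet N) p (nullField N p) ≠ 0 := by
  have hla := analyticAt_conormalDet hN
  have hker : ∀ᶠ z in 𝓝 p, conormalDet N z = 0 → fderiv ℝ ψ z (nullField N z) = 0 := by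
    filter_upwards [hdψ, hconf] with z h1 h2 h3
    rw [h1, fderiv_I_mul_nullField h2.1 h2.2.1 h2.2.2 h3, cross_self_smul]
  obtain ⟨hE, hF, h0⟩ := hconf.self_of_nhds
  have hm0 := fderiv_I_mul_nullField hE hF h0 hp
  constructor
  · intro hc
    refine transversal_of_hasCuspidalEdgeAt hc
      (hψ.eventually_analyticAt.mono fun z hz => hz.differentiableAt) hla.differentiableAt ?_ hd
      ?_ (hker.self_of_nhds hp)
    · filter_upwards [hdψ] with z hz h
      by_contra h'
      exact h (injective_fderiv_of_conormalDet_ne_zero hz h')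
    · intro h
      rw [h, mul_zero, map_zero] at hm0
      exact (smul_ne_zero h0 hNp) hm0.symm
  · intro hη
    set η := nullField N p with hηdef
    have hη0 : η ≠ 0 := by
      rintro h
      rw [h, map_zero] at hη
      exact hη rfl
    -- a tangent vector of the singular curve
    obtain ⟨w, hw0, hw⟩ : ∃ w : ℂ, w ≠ 0 ∧ fderiv ℝ (conormalDet N) p w = 0 := by
      set D := fderiv ℝ (conormalDet N) p
      have hDv : ∀ v : ℂ, D v = v.re * D 1 + v.im * D Complex.I := fun v => by
        have hv : v = v.re • (1 : ℂ) + v.im • Complex.I := by apply Complex.ext <;> simp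
        conv_lhs => rw [hv]
        rw [map_add, map_smul, map_smul]
        rfl
      refine ⟨⟨-D Complex.I, D 1⟩, fun h => hd ?_, ?_⟩
      · rw [Complex.ext_iff] at h
        simp only [Complex.zero_re, Complex.zero_im, neg_eq_zero] at h
        ext1 v
        rw [hDv, h.1, h.2]
        simp
      · rw [hDv]
        ring
    -- `I * w` is a combination of `I * η` and `η`
    obtain ⟨x, y, hy, hxy⟩ : ∃ x y : ℝ, y ≠ 0 ∧
        Complex.I * w = x • (Complex.I * η) + y • η := by
      refine ⟨(w / η).re, -(w / η).im, ?_, ?_⟩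
      · intro h
        have h1 : w = (w / η).re • η := by
          have : w = (w / η) * η := by field_simp
          conv_lhs => rw [this, ← Complex.re_add_im (w / η)]
          rw [neg_eq_zero] at h
          rw [h]
          simp
        rw [h1, map_smul, smul_eq_mul, mul_eq_zero] at hw
        rcases hw with hw | hw
        · rw [hw, zero_smul] at h1
          exact hw0 h1
        · exact hη hw
      · have h1 : w = (w / η) * η := by field_simp
        conv_lhs => rw [h1, ← Complex.re_add_im (w / η)]
        simp only [Complex.real_smul]
        push_cast
        linear_combination ((w / η).im * η : ℂ) * Complex.I_sq
    -- the data along the null line through `p`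
    let ℓ : ℝ → ℂ := fun t => p + t • η
    have hℓ : ∀ t, HasDerivAt ℓ η t := fun t => by
      have h := ((hasDerivAt_id t).smul_const η).const_add p
      rw [one_smul] at h
      exact h
    have hℓ0 : ℓ 0 = p := by simp [ℓ]
    have hℓa : AnalyticAt ℝ ℓ 0 := analyticAt_const.add (analyticAt_id.smul analyticAt_const)
    have hℓt : Filter.Tendsto ℓ (𝓝 0) (𝓝 p) := by
      have := hℓa.continuousAt.tendsto
      rwa [hℓ0] at this
    let n : ℝ → R3 := fun t => N (ℓ t)
    let a : ℝ → R3 := fun t => fderiv ℝ N (ℓ t) η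
    let m : ℝ → R3 := fun t => fderiv ℝ N (ℓ t) (Complex.I * η)
    have haa : AnalyticAt ℝ a 0 := by
      have := analyticAt_fderiv_apply hN η
      rw [← hℓ0] at this
      exact this.comp hℓa
    have hma : AnalyticAt ℝ m 0 := by
      have := analyticAt_fderiv_apply hN (Complex.I * η)
      rw [← hℓ0] at this
      exact this.comp hℓa
    have hn' : ∀ᶠ t in 𝓝 0, HasDerivAt n (a t) t := by
      filter_upwards [hℓt.eventually hN.eventually_analyticAt] with t ht
      exact ht.differentiableAt.hasFDerivAt.comp_hasDerivAt t (hℓ t)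
    have ha' : ∀ᶠ t in 𝓝 0, HasDerivAt a (deriv a t) t :=
      haa.eventually_analyticAt.mono fun t ht => ht.differentiableAt.hasDerivAt
    have hm' : ∀ᶠ t in 𝓝 0, HasDerivAt m (deriv m t) t :=
      hma.eventually_analyticAt.mono fun t ht => ht.differentiableAt.hasDerivAt
    have hm0' : m 0 = (partialU N p ⬝ᵥ partialU N p) • n 0 := by
      simp only [m, n, hℓ0]
      exact hm0
    -- the derivative of the conormal determinant in the null direction
    have hκ : det3 (n 0) (a 0) (deriv m 0) ≠ 0 := by
      have h1 : ∀ z, det3 (N z) (fderiv ℝ N z η) (fderiv ℝ N z (Complex.I * η)) =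
          (η.re ^ 2 + η.im ^ 2) * conormalDet N z := fun z => by
        rw [fderiv_eq_partial, fderiv_eq_partial, conormalDet]
        simp only [det3_eq]
        simp
        ring
      have h2 := hasDerivAt_det3 hn'.self_of_nhds ha'.self_of_nhds hm'.self_of_nhds
      have h3 : HasDerivAt (fun t => det3 (n t) (a t) (m t))
          ((η.re ^ 2 + η.im ^ 2) * fderiv ℝ (conormalDet N) p η) 0 := by
        have h4 : HasFDerivAt (conormalDet N) (fderiv ℝ (conormalDet N) p) (ℓ 0) := by
          rw [hℓ0]; exact hla.differentiableAt.hasFDerivAt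
        have h5 := (h4.comp_hasDerivAt (0 : ℝ) (hℓ 0)).const_mul (η.re ^ 2 + η.im ^ 2)
        exact h5.congr_of_eventuallyEq (.of_forall fun t => h1 (ℓ t))
      have h6 := h2.unique h3
      have h7 : det3 (a 0) (a 0) (m 0) = 0 := by simp only [det3_eq]; ring
      have h8 : det3 (n 0) (deriv a 0) (m 0) = 0 := by
        rw [hm0']
        simp only [det3_eq, Pi.smul_apply, smul_eq_mul]
        ring
      rw [h7, h8, zero_add, zero_add] at h6
      rw [h6]
      refine mul_ne_zero (fun h => hη0 ?_) hη
      apply Complex.ext <;> simp <;> nlinarith [sq_nonneg η.re, sq_nonneg η.im]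
    -- the derivatives of `ψ` along the null line
    have d1 : deriv (fun t : ℝ => ψ (p + t • η)) =ᶠ[𝓝 0]
        fun t => crossProduct (n t) (m t) := by
      filter_upwards [hℓt.eventually hψ.eventually_analyticAt, hℓt.eventually hdψ] with t h1 h2
      rw [← h2]
      exact (h1.differentiableAt.hasFDerivAt.comp_hasDerivAt t (hℓ t)).deriv
    have d2 : deriv (deriv (fun t : ℝ => ψ (p + t • η))) =ᶠ[𝓝 0]
        fun t => crossProduct (a t) (m t) + crossProduct (n t) (deriv m t) := by
      filter_upwards [d1.eventually_nhds, hn', hm'] with t h1 h2 h3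
      exact ((hasDerivAt_cross h2 h3).congr_of_eventuallyEq h1).deriv
    have hm'' : HasDerivAt (deriv m) (deriv (deriv m) 0) 0 :=
      hma.deriv.differentiableAt.hasDerivAt
    have d3 : deriv (deriv (deriv (fun t : ℝ => ψ (p + t • η)))) 0 =
        (crossProduct (deriv a 0) (m 0) + crossProduct (a 0) (deriv m 0)) +
        (crossProduct (a 0) (deriv m 0) + crossProduct (n 0) (deriv (deriv m) 0)) :=
      (((hasDerivAt_cross ha'.self_of_nhds hm'.self_of_nhds).add
        (hasDerivAt_cross hn'.self_of_nhds hm'')).congr_of_eventuallyEq d2).deriv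
    have dw : fderiv ℝ ψ p w =
        crossProduct (n 0) (x • (partialU N p ⬝ᵥ partialU N p) • n 0 + y • a 0) := by
      rw [hdψ.self_of_nhds, hxy, map_add, map_smul, map_smul, ← hm0']
      simp only [n, m, a, hℓ0]
    refine hasCuspidalEdgeAt_of_transversal hψ hla (analyticAt_nullField hN) hp hw hη hker ?_
    have d2' : deriv (deriv (fun t : ℝ => ψ (p + t • η))) 0 =
        crossProduct (a 0) (m 0) + crossProduct (n 0) (deriv m 0) := d2.self_of_nhds
    rw [d2', d3, dw, hm0', det3_null_derivatives]
    exact mul_ne_zero (mul_ne_zero two_ne_zero hy) (pow_ne_zero 2 hκ)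

/-- At a non-degenerate singular point the conormal does not vanish, and the conormal determinant
has a regular zero. -/
theorem conormalDet_of_isNondegenerateSingularPoint {p : ℂ} (hN : AnalyticAt ℝ N p)
    (hdψ : ∀ᶠ z in 𝓝 p, ∀ v,
      fderiv ℝ ψ z v = crossProduct (N z) (fderiv ℝ N z (Complex.I * v)))
    (hp : IsNondegenerateSingularPoint ψ p) :
    conormalDet N p = 0 ∧ N p ≠ 0 ∧ fderiv ℝ (conormalDet N) p ≠ 0 := by
  obtain ⟨hni, V, hV, hpV, n, hn, hd⟩ := hp
  have h0 : conormalDet N p = 0 := by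
    by_contra h
    exact hni (injective_fderiv_of_conormalDet_ne_zero hdψ.self_of_nhds h)
  have hnd : DifferentiableAt ℝ n p :=
    (hn.smooth.contDiffAt (hV.mem_nhds hpV)).differentiableAt (by simp)
  have hdot : DifferentiableAt ℝ (fun z => N z ⬝ᵥ n z) p := by
    have h1 := differentiableAt_pi.1 hN.differentiableAt
    have h2 := differentiableAt_pi.1 hnd
    simp only [dot_eq]
    exact (((h1 0).mul (h2 0)).add ((h1 1).mul (h2 1))).add ((h1 2).mul (h2 2))
  have hl := (analyticAt_conormalDet hN).differentiableAt.hasFDerivAt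
  have h1 : fderiv ℝ (singularityIdentifier ψ n) p =
      (N p ⬝ᵥ n p) • fderiv ℝ (conormalDet N) p := by
    have h2 := hl.mul hdot.hasFDerivAt
    rw [h0, zero_smul, zero_add] at h2
    refine (h2.congr_of_eventuallyEq ?_).fderiv
    filter_upwards [hdψ] with z hz
    exact singularityIdentifier_eq hz
  rw [h1] at hd
  refine ⟨h0, fun h => hd ?_, fun h => hd ?_⟩
  · rw [h, zero_dotProduct, zero_smul]
  · rw [h, smul_zero]

end Front

/-! ### The Weierstrass datum -/

/-- A real primitive of `2 Re (i ((φ + conj φ) χ' - (χ + conj χ) φ') dz)` for holomorphic `φ` and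
`χ` is real analytic: it equals `2 Re (i ∫ (φ dχ - χ dφ)) + Re (i (conj φ χ - conj χ φ))` up to a
constant. -/
theorem analyticAt_of_lelieuvre {V : Set ℂ} (hV : IsOpen V) {φ χ : ℂ → ℂ}
    (hφ : DifferentiableOn ℂ φ V) (hχ : DifferentiableOn ℂ χ V) {f : ℂ → ℝ}
    (hf : DifferentiableOn ℝ f V)
    (hd : ∀ z ∈ V, ∀ v, fderiv ℝ f z v = 2 * (Complex.I * ((φ z + star (φ z)) * deriv χ z -
      (χ z + star (χ z)) * deriv φ z) * v).re) {p : ℂ} (hp : p ∈ V) : AnalyticAt ℝ f p := by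
  obtain ⟨r, hr, hball⟩ := Metric.isOpen_iff.1 hV p hp
  have hφd : ∀ z ∈ V, HasDerivAt φ (deriv φ z) z := fun z hz =>
    (hφ.differentiableAt (hV.mem_nhds hz)).hasDerivAt
  have hχd : ∀ z ∈ V, HasDerivAt χ (deriv χ z) z := fun z hz =>
    (hχ.differentiableAt (hV.mem_nhds hz)).hasDerivAt
  have hG : DifferentiableOn ℂ (fun z => φ z * deriv χ z - χ z * deriv φ z) V :=
    (hφ.mul (hχ.deriv hV)).sub (hχ.mul (hφ.deriv hV))
  obtain ⟨H, hH⟩ := (hG.mono hball).isExactOn_ball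
  have hpb : p ∈ Metric.ball p r := Metric.mem_ball_self hr
  have hφa : AnalyticAt ℂ φ p := hφ.analyticAt (hV.mem_nhds hp)
  have hχa : AnalyticAt ℂ χ p := hχ.analyticAt (hV.mem_nhds hp)
  have hHa : AnalyticAt ℂ H p :=
    (show DifferentiableOn ℂ H (Metric.ball p r) from fun z hz =>
      (hH z hz).differentiableAt.differentiableWithinAt).analyticAt
      (Metric.isOpen_ball.mem_nhds hpb)
  let K : ℂ → ℝ := fun z => 2 * (Complex.I * H z).re +
    (Complex.I * (star (φ z) * χ z - star (χ z) * φ z)).re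
  have hconj : ∀ {ξ : ℂ → ℂ}, AnalyticAt ℝ ξ p → AnalyticAt ℝ (fun z => star (ξ z)) p :=
    fun h => (Complex.conjCLE.toContinuousLinearMap.analyticAt _).comp h
  have hre : ∀ {ξ : ℂ → ℂ}, AnalyticAt ℝ ξ p → AnalyticAt ℝ (fun z => (ξ z).re) p :=
    fun h => (Complex.reCLM.analyticAt _).comp h
  have hφr : AnalyticAt ℝ φ p := hφa.restrictScalars
  have hχr : AnalyticAt ℝ χ p := hχa.restrictScalars
  have hHr : AnalyticAt ℝ H p := hHa.restrictScalars
  have hKa : AnalyticAt ℝ K p :=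
    (analyticAt_const.mul (hre (analyticAt_const.mul hHr))).add
      (hre (analyticAt_const.mul (((hconj hφr).mul hχr).sub ((hconj hχr).mul hφr))))
  have hKd : ∀ z ∈ Metric.ball p r, DifferentiableAt ℝ K z ∧
      ∀ v, fderiv ℝ K z v = fderiv ℝ f z v := by
    intro z hz
    have h1 : HasFDerivAt φ _ z := (hφd z (hball hz)).hasFDerivAt.restrictScalars ℝ
    have h2 : HasFDerivAt χ _ z := (hχd z (hball hz)).hasFDerivAt.restrictScalars ℝ
    have h3 : HasFDerivAt H _ z := (hH z hz).hasFDerivAt.restrictScalars ℝ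
    have hs : ∀ {ξ : ℂ → ℂ} {ξ' : ℂ →L[ℝ] ℂ}, HasFDerivAt ξ ξ' z → HasFDerivAt
        (fun z => star (ξ z)) (Complex.conjCLE.toContinuousLinearMap.comp ξ') z := fun h =>
      Complex.conjCLE.toContinuousLinearMap.hasFDerivAt.comp z h
    have hr : ∀ {ξ : ℂ → ℂ} {ξ' : ℂ →L[ℝ] ℂ}, HasFDerivAt ξ ξ' z → HasFDerivAt
        (fun z => (ξ z).re) (Complex.reCLM.comp ξ') z := fun h =>
      Complex.reCLM.hasFDerivAt.comp z h
    have h4 : HasFDerivAt K _ z := ((hr (h3.const_mul Complex.I)).const_mul 2).add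
      (hr ((((hs h1).mul h2).sub ((hs h2).mul h1)).const_mul Complex.I))
    refine ⟨h4.differentiableAt, fun v => ?_⟩
    rw [h4.fderiv, hd z (hball hz)]
    simp
    ring
  have heq := Metric.isOpen_ball.exists_is_const_of_fderiv_eq_zero (𝕜 := ℝ)
    (f := fun z => f z - K z) (Metric.isConnected_ball hr).isPreconnected
    (fun z hz => ((hf.differentiableAt (hV.mem_nhds (hball hz))).sub
      (hKd z hz).1).differentiableWithinAt) (fun z hz => by
        rw [fderiv_fun_sub (hf.differentiableAt (hV.mem_nhds (hball hz))) (hKd z hz).1]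
        ext1 v
        simp [(hKd z hz).2 v])
  obtain ⟨c, hc⟩ := heq
  refine (hKa.add (analyticAt_const (v := c))).congr ?_
  filter_upwards [Metric.isOpen_ball.mem_nhds hpb] with z hz
  have := hc z hz
  simp only [Pi.add_apply] at this ⊢
  linarith

variable {V : Set ℂ} {ψ N : ℂ → R3} {Φ : ℂ → Fin 3 → ℂ}

theorem IsWeierstrassDatumOn.analyticAt_conormal (h : IsWeierstrassDatumOn V ψ N Φ) {z : ℂ}
    (hz : z ∈ V) : AnalyticAt ℝ N z ∧
      ∀ v j, fderiv ℝ N z v j = 2 * (deriv Φ z j * v).re := by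
  have hΦa : AnalyticAt ℂ Φ z := h.holomorphic.analyticAt (h.isOpen.mem_nhds hz)
  have hNΦ : ∀ j, (fun z => N z j) =ᶠ[𝓝 z] fun z => 2 * (Φ z j).re := fun j => by
    filter_upwards [h.isOpen.mem_nhds hz] with w hw
    have := congrArg Complex.re (h.conormal w hw j)
    simp at this
    rw [this]
    ring
  have hj : ∀ j, AnalyticAt ℂ (fun z => Φ z j) z := fun j =>
    ((ContinuousLinearMap.proj (R := ℂ) (φ := fun _ : Fin 3 => ℂ) j).analyticAt _).comp hΦa
  have hNj : ∀ j, AnalyticAt ℝ (fun z => N z j) z := fun j => by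
    have hjr : AnalyticAt ℝ (fun z => Φ z j) z := (hj j).restrictScalars
    exact (analyticAt_const.mul ((Complex.reCLM.analyticAt _).comp hjr)).congr (hNΦ j).symm
  have hN : AnalyticAt ℝ N z := analyticAt_pi_iff.2 hNj
  refine ⟨hN, fun v j => ?_⟩
  have h1 : HasFDerivAt (fun z => Φ z j) _ z :=
    ((hasDerivAt_pi.1 hΦa.differentiableAt.hasDerivAt) j).hasFDerivAt.restrictScalars ℝ
  have h2 := ((Complex.reCLM.hasFDerivAt.comp z h1).const_mul 2).congr_of_eventuallyEq (hNΦ j)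
  have h3 := (hasFDerivAt_pi'.1 hN.differentiableAt.hasFDerivAt) j
  have h4 := congrArg (fun T : ℂ →L[ℝ] ℝ => T v) (h3.unique h2)
  simp only [ContinuousLinearMap.comp_apply, ContinuousLinearMap.proj_apply] at h4
  rw [h4]
  simp
  ring

/-- The Lelieuvre formula in terms of the conormal map alone. -/
theorem IsWeierstrassDatumOn.fderiv_eq_cross (h : IsWeierstrassDatumOn V ψ N Φ) {z : ℂ}
    (hz : z ∈ V) (v : ℂ) :
    fderiv ℝ ψ z v = crossProduct (N z) (fderiv ℝ N z (Complex.I * v)) := by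
  obtain ⟨-, hN⟩ := h.analyticAt_conormal hz
  funext j
  rw [h.lelieuvre z hz, cross_eq]
  have hs : ∀ j, (Φ z + star (Φ z)) j = ((N z j : ℝ) : ℂ) := fun j => (h.conormal z hz j).symm
  rw [cross_apply]
  simp only [hs, hN]
  fin_cases j <;> simp <;> ring

theorem IsWeierstrassDatumOn.analyticAt (h : IsWeierstrassDatumOn V ψ N Φ) {z : ℂ}
    (hz : z ∈ V) : AnalyticAt ℝ ψ z := by
  have hΦ := differentiableOn_pi.1 h.holomorphic
  have hψ := differentiableOn_pi.1 h.differentiable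
  have hlel : ∀ j, ∀ w ∈ V, ∀ v, fderiv ℝ (fun z => ψ z j) w v =
      2 * (Complex.I * crossProduct (Φ w + star (Φ w)) (deriv Φ w) j * v).re := by
    intro j w hw v
    rw [← h.lelieuvre w hw]
    have h1 := (hasFDerivAt_pi'.1
      (h.differentiable.differentiableAt (h.isOpen.mem_nhds hw)).hasFDerivAt) j
    rw [h1.fderiv]
    rfl
  have hder : ∀ w ∈ V, ∀ j, deriv Φ w j = deriv (fun z => Φ z j) w := fun w hw j =>
    ((hasDerivAt_pi.1
      (h.holomorphic.differentiableAt (h.isOpen.mem_nhds hw)).hasDerivAt) j).deriv.symm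
  refine analyticAt_pi_iff.2 fun j => ?_
  fin_cases j
  · refine analyticAt_of_lelieuvre h.isOpen (hΦ 1) (hΦ 2) (hψ 0) (fun w hw v => ?_) hz
    rw [hlel 0 w hw, cross_apply, ← hder w hw, ← hder w hw]
    rfl
  · refine analyticAt_of_lelieuvre h.isOpen (hΦ 2) (hΦ 0) (hψ 1) (fun w hw v => ?_) hz
    rw [hlel 1 w hw, cross_apply, ← hder w hw, ← hder w hw]
    rfl
  · refine analyticAt_of_lelieuvre h.isOpen (hΦ 0) (hΦ 1) (hψ 2) (fun w hw v => ?_) hz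
    rw [hlel 2 w hw, cross_apply, ← hder w hw, ← hder w hw]
    rfl

/-! ### The Weierstrass representation -/

section Weierstrass

variable {N : ℂ → R3} {g ωhat : ℂ → ℂ} {p : ℂ}

/-- `N · m` for the normal vector `m = (2 Re g, 2 Im g, |g|² - 1)` of the minimal surface `N`. -/
noncomputable def gaussDot (N : ℂ → R3) (g : ℂ → ℂ) (z : ℂ) : ℝ :=
  N z 0 * (2 * (g z).re) + N z 1 * (2 * (g z).im) + N z 2 * ((g z).re ^ 2 + (g z).im ^ 2 - 1)

theorem conormalDet_eq_gaussDot {z : ℂ}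
    (h : ∀ (v : ℂ) (j : Fin 3), fderiv ℝ N z v j = (weierstrassVector (g z) j * ωhat z * v).re) :
    conormalDet N z = ((ωhat z).re ^ 2 + (ωhat z).im ^ 2) *
      (1 + (g z).re ^ 2 + (g z).im ^ 2) * gaussDot N g z := by
  rw [conormalDet, det3_eq, gaussDot]
  simp only [partialU, partialV, h, weierstrassVector]
  simp [pow_two]
  ring

theorem fderiv_gaussDot (hN : DifferentiableAt ℝ N p) (hg : DifferentiableAt ℂ g p)
    (h : ∀ (v : ℂ) (j : Fin 3), fderiv ℝ N p v j = (weierstrassVector (g p) j * ωhat p * v).re) :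
    DifferentiableAt ℝ (gaussDot N g) p ∧ ∀ v, fderiv ℝ (gaussDot N g) p v =
      2 * (((N p 0 : ℂ) - Complex.I * (N p 1 : ℂ) + star (g p) * (N p 2 : ℂ)) *
        deriv g p * v).re := by
  have hj := fun j => (hasFDerivAt_pi'.1 hN.hasFDerivAt) j
  have hgr : HasFDerivAt g _ p := hg.hasDerivAt.hasFDerivAt.restrictScalars ℝ
  have hre := Complex.reCLM.hasFDerivAt.comp p hgr
  have him := Complex.imCLM.hasFDerivAt.comp p hgr
  have hd : HasFDerivAt (gaussDot N g) _ p :=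
    (((hj 0).mul (hre.const_mul 2)).add ((hj 1).mul (him.const_mul 2))).add
      ((hj 2).mul (((hre.pow 2).add (him.pow 2)).sub_const 1))
  refine ⟨hd.differentiableAt, fun v => ?_⟩
  rw [hd.fderiv]
  simp [h, weierstrassVector, pow_two]
  ring

/-- The differential of the conormal determinant at a singular point. The differential of `N` does
not contribute, since it is orthogonal to `(2 Re g, 2 Im g, |g|² - 1)`. -/
theorem fderiv_conormalDet (hN : AnalyticAt ℝ N p) (hg : AnalyticAt ℂ g p)
    (hω : AnalyticAt ℂ ωhat p)
    (h : ∀ᶠ z in 𝓝 p, ∀ (v : ℂ) (j : Fin 3),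
      fderiv ℝ N z v j = (weierstrassVector (g z) j * ωhat z * v).re)
    (h0 : gaussDot N g p = 0) (v : ℂ) :
    fderiv ℝ (conormalDet N) p v = ((ωhat p).re ^ 2 + (ωhat p).im ^ 2) *
      (1 + (g p).re ^ 2 + (g p).im ^ 2) * (2 * (((N p 0 : ℂ) - Complex.I * (N p 1 : ℂ) +
        star (g p) * (N p 2 : ℂ)) * deriv g p * v).re) := by
  obtain ⟨h1, h2⟩ := fderiv_gaussDot hN.differentiableAt hg.differentiableAt h.self_of_nhds
  rw [← h2]
  have hr : ∀ {ξ : ℂ → ℂ}, AnalyticAt ℂ ξ p →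
      DifferentiableAt ℝ (fun z => (ξ z).re) p ∧ DifferentiableAt ℝ (fun z => (ξ z).im) p :=
    fun hξ => by
      have hξr : DifferentiableAt ℝ _ p := hξ.differentiableAt.restrictScalars ℝ
      exact ⟨Complex.reCLM.differentiableAt.comp p hξr, Complex.imCLM.differentiableAt.comp p hξr⟩
  have hK : DifferentiableAt ℝ (fun z => ((ωhat z).re ^ 2 + (ωhat z).im ^ 2) *
      (1 + (g z).re ^ 2 + (g z).im ^ 2)) p :=
    (((hr hω).1.pow 2).add ((hr hω).2.pow 2)).mul
      (((differentiableAt_const 1).add ((hr hg).1.pow 2)).add ((hr hg).2.pow 2))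
  have h3 := (hK.hasFDerivAt.mul h1.hasFDerivAt).congr_of_eventuallyEq
    (h.mono fun z hz => conormalDet_eq_gaussDot hz)
  rw [h3.fderiv, h0, zero_smul, add_zero]
  rfl

end Weierstrass

/-! ### The criteria in terms of one complex number

With `N p = Re (s • weierstrassVector (g p))`, all the expressions of the criteria are multiples of
`conj s * g'` or of the imaginary part of `s² g' conj ωhat`. -/

section Pointwise

variable {N : ℂ → R3} {g ωhat : ℂ → ℂ} {p s : ℂ}

theorem ofReal_coord (hs : ∀ j, N p j = (weierstrassVector (g p) j * s).re) (j : Fin 3) :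
    (N p j : ℂ) = (weierstrassVector (g p) j * s + star (weierstrassVector (g p) j * s)) / 2 := by
  rw [hs, Complex.re_eq_add_conj]
  rfl

theorem conj_pairing (hs : ∀ j, N p j = (weierstrassVector (g p) j * s).re) :
    (N p 0 : ℂ) - Complex.I * (N p 1 : ℂ) + star (g p) * (N p 2 : ℂ) =
      s * (1 + g p * conj (g p)) := by
  simp only [ofReal_coord hs, weierstrassVector]
  simp
  linear_combination (-(1 + g p ^ 2) * s / 2 + (1 + conj (g p) ^ 2) * conj s / 2) * Complex.I_sq

theorem nondegeneracyTerm_eq (hs : ∀ j, N p j = (weierstrassVector (g p) j * s).re) :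
    nondegeneracyTerm N g p = (1 + g p * conj (g p)) ^ 2 * conj s * deriv g p := by
  rw [nondegeneracyTerm]
  congr 1
  simp only [ofReal_coord hs, weierstrassVector]
  simp
  linear_combination ((1 + g p ^ 2) *
    ((1 + g p ^ 2) * s / 2 - (1 + conj (g p) ^ 2) * conj s / 2)) * Complex.I_sq

theorem cuspTerm_eq (hs : ∀ j, N p j = (weierstrassVector (g p) j * s).re) :
    cuspTerm N g ωhat p =
      -(1 - Complex.normSq (g p) ^ 2) ^ 2 * (s ^ 2 * deriv g p * conj (ωhat p)).im := by
  have h1 : (N p 0 : ℂ) * (1 + g p ^ 2) + Complex.I * (N p 1 : ℂ) * (1 - g p ^ 2) =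
      (1 - (g p * conj (g p)) ^ 2) * conj s := by
    simp only [ofReal_coord hs, weierstrassVector]
    simp
    linear_combination ((1 - g p ^ 2) *
      ((1 + g p ^ 2) * s / 2 - (1 + conj (g p) ^ 2) * conj s / 2)) * Complex.I_sq
  have h2 : ((1 - (g p * conj (g p)) ^ 2) * conj s) ^ 2 * star (deriv g p) * ωhat p =
      (((1 - Complex.normSq (g p) ^ 2) ^ 2 : ℝ) : ℂ) *
        conj (s ^ 2 * deriv g p * conj (ωhat p)) := by
    rw [Complex.mul_conj]
    simp
    ring
  rw [cuspTerm, h1, h2, Complex.im_ofReal_mul, Complex.conj_im]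
  ring

theorem cuspTermRe_eq (hs : ∀ j, N p j = (weierstrassVector (g p) j * s).re)
    (hg : g p * conj (g p) = 1) :
    cuspTermRe N g ωhat p = 4 * (g p).re ^ 2 * (s ^ 2 * deriv g p * conj (ωhat p)).im := by
  have h1 : (N p 1 : ℂ) - Complex.I * (N p 2 : ℂ) * ((g p).re : ℂ) =
      -2 * Complex.I * conj (g p) * (g p).re * conj s := by
    simp only [ofReal_coord hs, weierstrassVector, Complex.re_eq_add_conj]
    simp
    linear_combination (-Complex.I * s / 2 + Complex.I * conj s / 2) * hg
  have h2 : (-2 * Complex.I * conj (g p) * (g p).re * conj s) ^ 2 * star (deriv g p) * g p ^ 2 *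
      ωhat p = ((-4 * (g p).re ^ 2 : ℝ) : ℂ) * conj (s ^ 2 * deriv g p * conj (ωhat p)) := by
    simp
    linear_combination (4 * conj (g p) ^ 2 * (g p).re ^ 2 * conj s ^ 2 * conj (deriv g p) *
      g p ^ 2 * ωhat p) * Complex.I_sq - (4 * (g p).re ^ 2 * conj s ^ 2 * conj (deriv g p) *
      ωhat p * (g p * conj (g p) + 1)) * hg
  rw [cuspTermRe, h1, h2, Complex.im_ofReal_mul, Complex.conj_im]
  ring

theorem cuspTermIm_eq (hs : ∀ j, N p j = (weierstrassVector (g p) j * s).re)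
    (hg : g p * conj (g p) = 1) :
    cuspTermIm N g ωhat p = 4 * (g p).im ^ 2 * (s ^ 2 * deriv g p * conj (ωhat p)).im := by
  have him : Complex.I * ((g p).im : ℂ) = (g p - conj (g p)) / 2 := by
    rw [Complex.sub_conj]
    push_cast
    ring
  have h1 : (N p 0 : ℂ) + Complex.I * (N p 2 : ℂ) * ((g p).im : ℂ) =
      2 * conj (g p) * (Complex.I * (g p).im) * conj s := by
    rw [mul_right_comm, him]
    simp only [ofReal_coord hs, weierstrassVector]
    simp
    linear_combination (-s / 2 - conj s / 2) * hg
  have h2 : (2 * conj (g p) * (Complex.I * (g p).im) * conj s) ^ 2 * star (deriv g p) *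
      g p ^ 2 * ωhat p =
      ((-4 * (g p).im ^ 2 : ℝ) : ℂ) * conj (s ^ 2 * deriv g p * conj (ωhat p)) := by
    simp
    linear_combination (4 * conj (g p) ^ 2 * (g p).im ^ 2 * conj s ^ 2 * conj (deriv g p) *
      g p ^ 2 * ωhat p) * Complex.I_sq - (4 * (g p).im ^ 2 * conj s ^ 2 * conj (deriv g p) *
      ωhat p * (g p * conj (g p) + 1)) * hg
  rw [cuspTermIm, h1, h2, Complex.im_ofReal_mul, Complex.conj_im]
  ring

end Pointwise

/-- At a non-degenerate singular point there is a nonzero `s` with `N p = Re (s • W)`, where `W` is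
the Weierstrass vector of `g p`, and `ψ` has a cuspidal edge exactly if `s² g' conj ωhat` is not
real: `s / ωhat` is a positive multiple of the rotated null direction, and the transversality is tested by
the second fundamental form of `N`, the real part of a multiple of the Hopf differential
`g' ωhat dz²`, on the null direction and the rotated null direction. -/
theorem exists_conormal_parameter {U : Set ℂ} (hU : IsOpen U) {ψ N : ℂ → R3}
    (hψ : IsAffineMaxface U ψ N) {g ωhat : ℂ → ℂ} (hg : IsWeierstrassPair U N g ωhat) {p : ℂ}
    (hpU : p ∈ U) (hgp : AnalyticAt ℂ g p) (hp : IsNondegenerateSingularPoint ψ p) :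
    ∃ s : ℂ, s ≠ 0 ∧ deriv g p ≠ 0 ∧ (∀ j, N p j = (weierstrassVector (g p) j * s).re) ∧
      (HasCuspidalEdgeAt ψ p ↔ (s ^ 2 * deriv g p * conj (ωhat p)).im ≠ 0) := by
  obtain ⟨V, -, hpV, Φ, hΦ⟩ := hψ.maximal.exists_datum p hpU
  have hN := (hΦ.analyticAt_conormal hpV).1
  have hdψ : ∀ᶠ z in 𝓝 p, ∀ v,
      fderiv ℝ ψ z v = crossProduct (N z) (fderiv ℝ N z (Complex.I * v)) :=
    Filter.eventually_of_mem (hΦ.isOpen.mem_nhds hpV) fun z hz => hΦ.fderiv_eq_cross hz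
  have hmin := hψ.conormal_minimal
  have hconf : ∀ᶠ z in 𝓝 p, partialU N z ⬝ᵥ partialU N z = partialV N z ⬝ᵥ partialV N z ∧
      partialU N z ⬝ᵥ partialV N z = 0 ∧ partialU N z ⬝ᵥ partialU N z ≠ 0 := by
    filter_upwards [hU.mem_nhds hpU] with z hz
    refine ⟨hmin.conformal_length z hz, hmin.conformal_angle z hz, fun h => ?_⟩
    have h1 : fderiv ℝ N z 1 = fderiv ℝ N z 0 := by
      rw [map_zero]
      exact dotProduct_self_eq_zero.1 h
    exact one_ne_zero (hmin.immersion z hz h1)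
  obtain ⟨h0, hNp, hd⟩ := conormalDet_of_isNondegenerateSingularPoint hN hdψ hp
  obtain ⟨hE, hF, hE0⟩ := hconf.self_of_nhds
  have hrep : ∀ᶠ z in 𝓝 p, ∀ (v : ℂ) (j : Fin 3),
      fderiv ℝ N z v j = (weierstrassVector (g z) j * ωhat z * v).re := by
    filter_upwards [hU.mem_nhds hpU, hgp.eventually_analyticAt] with z hz hgz
    exact hg.representation z hz hgz
  have hω : AnalyticAt ℂ ωhat p := hg.holomorphic.analyticAt (hU.mem_nhds hpU)
  have hω0 : ωhat p ≠ 0 := by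
    intro h
    apply hE0
    have : partialU N p = 0 := by
      funext j
      rw [partialU, hrep.self_of_nhds, h]
      simp
    rw [this, zero_dotProduct]
  have hωn : (ωhat p).re ^ 2 + (ωhat p).im ^ 2 ≠ 0 := by
    have := Complex.normSq_pos.2 hω0
    rw [Complex.normSq_apply] at this
    nlinarith
  have hgn : 1 + (g p).re ^ 2 + (g p).im ^ 2 ≠ 0 := by positivity
  have hμ : gaussDot N g p = 0 := by
    rw [conormalDet_eq_gaussDot hrep.self_of_nhds] at h0
    exact (mul_eq_zero.1 h0).resolve_left (mul_ne_zero hωn hgn)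
  have hdl := fderiv_conormalDet hN hgp hω hrep hμ
  have hg' : deriv g p ≠ 0 := by
    intro h
    apply hd
    ext1 v
    rw [hdl, h]
    simp
  set e := partialU N p ⬝ᵥ partialU N p with he
  have hec : (e : ℂ) ≠ 0 := by exact_mod_cast hE0
  obtain ⟨s, hs⟩ : ∃ s, s = ωhat p * (Complex.I * nullField N p) / e := ⟨_, rfl⟩
  have hsN : ∀ j, N p j = (weierstrassVector (g p) j * s).re := by
    intro j
    have h1 := congrFun (fderiv_I_mul_nullField hE hF hE0 h0) j
    rw [hrep.self_of_nhds, Pi.smul_apply, smul_eq_mul, ← he] at h1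
    have h2 : weierstrassVector (g p) j * s =
        weierstrassVector (g p) j * ωhat p * (Complex.I * nullField N p) / e := by
      rw [hs]; ring
    rw [h2, Complex.div_ofReal_re, h1]
    field_simp
  have hs0 : s ≠ 0 := by
    intro h
    apply hNp
    funext j
    rw [hsN, h]
    simp
  refine ⟨s, hs0, hg', hsN, ?_⟩
  rw [hasCuspidalEdgeAt_iff_transversal (hΦ.analyticAt hpV) hN hdψ hconf h0 hNp hd, hdl,
    conj_pairing hsN]
  -- `|ωhat|² s g' η = - i e s² g' conj ωhat`
  have hη : ωhat p * nullField N p = -Complex.I * e * s := by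
    rw [hs]
    field_simp
    linear_combination nullField N p * Complex.I_sq
  have hωsq : (((ωhat p).re ^ 2 + (ωhat p).im ^ 2 : ℝ) : ℂ) = ωhat p * conj (ωhat p) := by
    rw [Complex.mul_conj, Complex.normSq_apply]
    push_cast
    ring
  have hgsq : g p * conj (g p) = ((1 + (g p).re ^ 2 + (g p).im ^ 2 - 1 : ℝ) : ℂ) := by
    rw [Complex.mul_conj, Complex.normSq_apply]
    push_cast
    ring
  have key : ((ωhat p).re ^ 2 + (ωhat p).im ^ 2) *
      (s * (1 + g p * conj (g p)) * deriv g p * nullField N p).re =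
      (1 + (g p).re ^ 2 + (g p).im ^ 2) * e * (s ^ 2 * deriv g p * conj (ωhat p)).im := by
    rw [← Complex.re_ofReal_mul, hωsq]
    have h1 : ωhat p * conj (ωhat p) *
        (s * (1 + g p * conj (g p)) * deriv g p * nullField N p) =
        (((1 + (g p).re ^ 2 + (g p).im ^ 2) * e : ℝ) : ℂ) *
          (-Complex.I * (s ^ 2 * deriv g p * conj (ωhat p))) := by
      rw [hgsq]
      push_cast
      linear_combination (conj (ωhat p) * s * (1 + (g p).re ^ 2 + (g p).im ^ 2 : ℂ) *
        deriv g p) * hη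
    rw [h1, Complex.re_ofReal_mul]
    simp
  have hfin : ((ωhat p).re ^ 2 + (ωhat p).im ^ 2) * (1 + (g p).re ^ 2 + (g p).im ^ 2) *
      (2 * (s * (1 + g p * conj (g p)) * deriv g p * nullField N p).re) =
      (2 * (1 + (g p).re ^ 2 + (g p).im ^ 2) ^ 2 * e) *
        (s ^ 2 * deriv g p * conj (ωhat p)).im := by
    linear_combination (2 * (1 + (g p).re ^ 2 + (g p).im ^ 2)) * key
  rw [hfin, mul_ne_zero_iff, and_iff_right]
  exact mul_ne_zero (mul_ne_zero two_ne_zero (pow_ne_zero 2 hgn)) hE0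

end AffineMaxface

theorem proposition4p5 (U : Set ℂ) (hU : IsOpen U) (hU' : IsConnected U)
    (ψ N : ℂ → AffineMaxface.R3) (hψ : AffineMaxface.IsAffineMaxface U ψ N)
    (g ωhat : ℂ → ℂ) (hg : AffineMaxface.IsWeierstrassPair U N g ωhat)
    (p : ℂ) (hpU : p ∈ U) (hgp : AnalyticAt ℂ g p)
    (hp : AffineMaxface.IsNondegenerateSingularPoint ψ p) :
    (‖g p‖ ≠ 1 →
      (AffineMaxface.HasCuspidalEdgeAt ψ p ↔
        AffineMaxface.nondegeneracyTerm N g p ≠ 0 ∧ AffineMaxface.cuspTerm N g ωhat p ≠ 0)) ∧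
    (‖g p‖ = 1 →
      ((g p).re ≠ 0 →
        (AffineMaxface.HasCuspidalEdgeAt ψ p ↔
          AffineMaxface.nondegeneracyTerm N g p ≠ 0 ∧
            AffineMaxface.cuspTermRe N g ωhat p ≠ 0)) ∧
      ((g p).im ≠ 0 →
        (AffineMaxface.HasCuspidalEdgeAt ψ p ↔
          AffineMaxface.nondegeneracyTerm N g p ≠ 0 ∧
            AffineMaxface.cuspTermIm N g ωhat p ≠ 0))) := by
  obtain ⟨s, hs0, hg', hs, hiff⟩ :=
    AffineMaxface.exists_conormal_parameter hU hψ hg hpU hgp hp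
  have hnd : AffineMaxface.nondegeneracyTerm N g p ≠ 0 := by
    rw [AffineMaxface.nondegeneracyTerm_eq hs, Complex.mul_conj]
    refine mul_ne_zero (mul_ne_zero (pow_ne_zero 2 ?_) (star_ne_zero.2 hs0)) hg'
    have : 0 < 1 + Complex.normSq (g p) := by
      have := Complex.normSq_nonneg (g p)
      linarith
    exact_mod_cast this.ne'
  refine ⟨fun hn => ?_, fun hn => ?_⟩
  · rw [hiff, and_iff_right hnd, AffineMaxface.cuspTerm_eq hs, mul_ne_zero_iff, and_iff_right]
    rw [Complex.normSq_eq_norm_sq]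
    refine neg_ne_zero.2 (pow_ne_zero 2 fun h => hn ?_)
    have h1 : ‖g p‖ ^ 4 = 1 := by linear_combination -h
    exact (pow_eq_one_iff_of_nonneg (norm_nonneg _) (by norm_num)).1 h1
  · have hg1 : g p * (starRingEnd ℂ) (g p) = 1 := by
      rw [Complex.mul_conj, Complex.normSq_eq_norm_sq, hn]
      simp
    refine ⟨fun hr => ?_, fun hr => ?_⟩
    · rw [hiff, and_iff_right hnd, AffineMaxface.cuspTermRe_eq hs hg1, mul_ne_zero_iff,
        and_iff_right]
      exact mul_ne_zero four_ne_zero (pow_ne_zero 2 hr)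
    · rw [hiff, and_iff_right hnd, AffineMaxface.cuspTermIm_eq hs hg1, mul_ne_zero_iff,
        and_iff_right]
      exact mul_ne_zero four_ne_zero (pow_ne_zero 2 hr)
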